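/- Let $m>0$, $\alpha\in[1,2)$, $T>0$, and let $\phi_-,\phi_+\in\mathbb R$ satisfy $|\phi_+-\phi_-|\le 2\pi$. Consider the planar Kepler-type problem $$\ddot x(t)=-\frac{m\,x(t)}{|x(t)|^{\alpha+2}},\qquad x(t)\in\mathbb C\setminus\{0\},$$ and, for $x\in H^1([-T,T],\mathbb C)$, its action $$\bar A_T(x)=\int_{-T}^{T}\Big(\tfrac12|\dot x(t)|^2+\frac{m}{\alpha|x(t)|^{\alpha}}\Big)\,dt\in[0,\infty]$$ (the integrand is $+\infty$ where $x(t)=0$). Let $\bar x$ be the parabolic collision-ejection solution: $\bar x(t)=(\mu|t|)^{\frac{2}{\alpha+2}}e^{i\phi_+}$ for $t\ge 0$ and $\bar x(t)=(\mu|t|)^{\frac{2}{\alpha+2}}e^{i\phi_-}$ for $t\le 0$, where $\mu=(\alpha+2)\big(\tfrac{m}{2\alpha}\big)^{1/2}$. Let $\Gamma^*_T(\bar x)$ be the set of all $x\in H^1([-T,T],\mathbb C)$ with $x(t)\neq 0$ for all $t\in[-T,T]$ and $x(\pm T)=\bar x(\pm T)$ for which there is a continuous $\theta:[-T,T]\to\mathbb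 R$ with $x=|x|e^{i\theta}$ and $\theta(\pm T)=\phi_\pm$. Let $\Gamma_T(\bar x)$ be its weak (sequential) closure in $H^1([-T,T],\mathbb C)$, that is, the set of limits of weakly convergent sequences of elements of $\Gamma^*_T(\bar x)$, and let $\bar c_T(\bar x)=\inf\{\bar A_T(x):x\in\Gamma_T(\bar x)\}$. Then $\bar c_T(\bar x)$ is finite and there is a $\gamma\in\Gamma_T(\bar x)$ with $\bar A_T(\gamma)=\bar c_T(\bar x)$. Moreover, every such $\gamma$ has the following properties. 1. If $\alpha\in(1,2)$, then $\gamma\in\Gamma^*_T(\bar x)$ and $\bar A_T(\gamma)<\bar A_T(\bar x)$. 2. If $\alpha=1$ and $|\phi_+-\phi_-|<2\pi$, then $\gamma\in\Gamma^*_T(\bar x)$ and $\bar A_T(\gamma)<\bar A_T(\bar x)$. 3. If $\phi_+\ne\phi_-$, then $\gamma$ is twice differentiable and satisfies the Kepler-type equation at all times $t\in[-T,T]$ with $\gamma(t)\neq 0$ (with one-sided derivatives at $t=\pm T$); in particular, in the situations of 1 and 2 it is a classical solution on all of $[-T,T]$. -/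

import Mathlib

open MeasureTheory Set Filter Topology
open scoped ENNReal

noncomputable section

namespace Kepler

/-! ### The Sobolev space `H¹([-T, T], ℂ)` -/

/-- Lebesgue measure on `[-T, T]`. -/
abbrev timeMeasure (T : ℝ) : Measure ℝ := volume.restrict (Icc (-T) T)

/-- `x` is (the continuous representative of) an `H¹` function on `[-T, T]`: it is absolutely
continuous there and its almost everywhere derivative is square integrable.
Only the restriction of `x` to `[-T, T]` matters. -/
structure MemH1 (T : ℝ) (x : ℝ → ℂ) : Prop where
  absCont : AbsolutelyContinuousOnInterval x (-T) T
  memLp_deriv : MemLp (deriv x) 2 (timeMeasure T)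

theorem ae_differentiableAt_of_absCont {T : ℝ} {x : ℝ → ℂ}
    (hx : AbsolutelyContinuousOnInterval x (-T) T) :
    ∀ᵐ t ∂(timeMeasure T), DifferentiableAt ℝ x t := by
  have h := hx.boundedVariationOn.locallyBoundedVariationOn.ae_differentiableWithinAt_of_mem
  have hne : ∀ᵐ t : ℝ, t ≠ -T ∧ t ≠ T := by
    have h1 : ∀ᵐ t : ℝ, t ≠ -T := by simp [ae_iff]
    have h2 : ∀ᵐ t : ℝ, t ≠ T := by simp [ae_iff]
    filter_upwards [h1, h2] with t a b using ⟨a, b⟩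
  rw [timeMeasure, ae_restrict_iff' measurableSet_Icc]
  filter_upwards [h, hne] with t ht hne htI
  have hlt1 : -T < t := lt_of_le_of_ne htI.1 (Ne.symm hne.1)
  have hlt2 : t < T := lt_of_le_of_ne htI.2 hne.2
  have hu : uIcc (-T) T ∈ 𝓝 t := by
    rw [uIcc_of_le (by linarith)]
    exact Icc_mem_nhds hlt1 hlt2
  exact (ht (mem_of_mem_nhds hu)).differentiableAt hu

theorem deriv_add_ae {T : ℝ} {x y : ℝ → ℂ} (hx : MemH1 T x) (hy : MemH1 T y) :
    deriv (x + y) =ᵐ[timeMeasure T] deriv x + deriv y := by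
  filter_upwards [ae_differentiableAt_of_absCont hx.absCont,
    ae_differentiableAt_of_absCont hy.absCont] with t h1 h2
  simpa using deriv_add h1 h2

theorem deriv_smul_ae {T : ℝ} (c : ℂ) {x : ℝ → ℂ} (hx : MemH1 T x) :
    deriv (c • x) =ᵐ[timeMeasure T] c • deriv x := by
  filter_upwards [ae_differentiableAt_of_absCont hx.absCont] with t h1
  simpa using deriv_const_smul c h1

theorem MemH1.memLp {T : ℝ} {x : ℝ → ℂ} (hx : MemH1 T x) : MemLp x 2 (timeMeasure T) := by
  have hc : ContinuousOn x (Icc (-T) T) := hx.absCont.continuousOn.mono Icc_subset_uIcc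
  obtain ⟨C, hC⟩ := isCompact_Icc.exists_bound_of_continuousOn hc
  refine MemLp.of_bound (hc.aestronglyMeasurable measurableSet_Icc) C ?_
  rw [ae_restrict_iff' measurableSet_Icc]
  exact ae_of_all _ hC

/-- The vector space of `H¹` curves on `[-T, T]`, as honest functions. -/
def H1Curve (T : ℝ) : Submodule ℂ (ℝ → ℂ) where
  carrier := {x | MemH1 T x}
  zero_mem' := ⟨
      ContDiffOn.absolutelyContinuousOnInterval (f := fun _ : ℝ => (0 : ℂ))
        (a := -T) (b := T) contDiffOn_const, by
      have : deriv (0 : ℝ → ℂ) = 0 := by ext t; exact deriv_const t 0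
      rw [this]; exact MemLp.zero⟩
  add_mem' {_ _} hx hy := ⟨hx.absCont.add hy.absCont,
    (hx.memLp_deriv.add hy.memLp_deriv).ae_eq (deriv_add_ae hx hy).symm⟩
  smul_mem' c _ hx := ⟨hx.absCont.const_smul c,
    (hx.memLp_deriv.const_smul c).ae_eq (deriv_smul_ae c hx).symm⟩

/-- `L²([-T, T], ℂ)`. -/
abbrev L2 (T : ℝ) := Lp ℂ 2 (timeMeasure T)

/-- The map `x ↦ (x, ẋ)` into the Hilbert space `L² × L²`. -/
def jet (T : ℝ) : H1Curve T →ₗ[ℂ] WithLp 2 (L2 T × L2 T) where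
  toFun x := WithLp.toLp 2 (MemLp.toLp _ (MemH1.memLp x.2), MemLp.toLp _ x.2.memLp_deriv)
  map_add' x y := by
    rw [← WithLp.toLp_add, Prod.mk_add_mk, ← MemLp.toLp_add, ← MemLp.toLp_add]
    congr 2
    exact MemLp.toLp_congr _ _ (deriv_add_ae x.2 y.2)
  map_smul' c x := by
    rw [RingHom.id_apply, ← WithLp.toLp_smul, Prod.smul_mk, ← MemLp.toLp_const_smul,
      ← MemLp.toLp_const_smul]
    congr 2
    exact MemLp.toLp_congr _ _ (deriv_smul_ae c x.2)

/-- The Sobolev space `H¹([-T, T], ℂ)`, with the norm `(‖x‖² + ‖ẋ‖²)^(1/2)` (norms in `L²`). -/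
abbrev H1 (T : ℝ) := LinearMap.range (jet T)

/-- The element of the Sobolev space given by an `H¹` curve. -/
def toH1 (T : ℝ) : H1Curve T →ₗ[ℂ] H1 T := (jet T).rangeRestrict

/-- `x n ⇀ y` weakly in `H¹([-T, T], ℂ)`. -/
def WeaklyTendsto (T : ℝ) (x : ℕ → H1Curve T) (y : H1Curve T) : Prop :=
  Tendsto (fun n => toWeakSpace ℂ (H1 T) (toH1 T (x n))) atTop
    (𝓝 (toWeakSpace ℂ (H1 T) (toH1 T y)))

/-- The weak closure in the sense of the direct method: all limits of weakly convergent sequences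
of elements of `S`. -/
def weakClosure (T : ℝ) (S : Set (H1Curve T)) : Set (H1Curve T) :=
  {y | ∃ x : ℕ → H1Curve T, (∀ n, x n ∈ S) ∧ WeaklyTendsto T x y}

/-! ### The Kepler-type problem -/

/-- The negative potential `m / (α |z|^α)`, equal to `∞` at `z = 0` (for `m > 0`, `α > 0`). -/
def potential (m α : ℝ) (z : ℂ) : ℝ≥0∞ := ENNReal.ofReal (m / α) / ‖z‖ₑ ^ α

/-- The action `∫_{-T}^{T} (|ẋ|² / 2 + m / (α |x|^α)) dt`, with values in `[0, ∞]`. -/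
def action (m α T : ℝ) (x : ℝ → ℂ) : ℝ≥0∞ :=
  ∫⁻ t in Icc (-T) T, (ENNReal.ofReal (‖deriv x t‖ ^ 2 / 2) + potential m α (x t))

/-- The curve `x` solves `ẍ = - m x / |x|^(α + 2)` on the set of times `s`, without collision
(one-sided derivatives at end points of `s` that belong to `s`). -/
def IsSolutionOn (m α : ℝ) (s : Set ℝ) (x : ℝ → ℂ) : Prop :=
  ∃ v : ℝ → ℂ, ∀ t ∈ s, x t ≠ 0 ∧ HasDerivWithinAt x (v t) s t ∧
    HasDerivWithinAt v (-(m / ‖x t‖ ^ (α + 2)) • x t) s t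

/-- The constant `μ = (α + 2) (m / (2 α))^(1/2)`. -/
def mu (m α : ℝ) : ℝ := (α + 2) * (m / (2 * α)) ^ (1 / 2 : ℝ)

/-- The parabolic collision-ejection solution with angles `φm` (for `t < 0`) and `φp`
(for `t > 0`). -/
def xbar (m α φm φp : ℝ) (t : ℝ) : ℂ :=
  (((mu m α * |t|) ^ (2 / (α + 2)) : ℝ) : ℂ) *
    Complex.exp ((if 0 ≤ t then φp else φm : ℝ) * Complex.I)

/-- The collision-free `H¹` curves on `[-T, T]` with the same end points as the collision-ejection
solution, such that a continuous determination of the argument runs from `φm` to `φp`. -/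
def GammaStar (m α T φm φp : ℝ) : Set (H1Curve T) :=
  {x | (∀ t ∈ Icc (-T) T, (x : ℝ → ℂ) t ≠ 0) ∧
    (x : ℝ → ℂ) (-T) = xbar m α φm φp (-T) ∧ (x : ℝ → ℂ) T = xbar m α φm φp T ∧
    ∃ θ : ℝ → ℝ, ContinuousOn θ (Icc (-T) T) ∧ θ (-T) = φm ∧ θ T = φp ∧
      ∀ t ∈ Icc (-T) T,
        (x : ℝ → ℂ) t = (‖(x : ℝ → ℂ) t‖ : ℂ) * Complex.exp ((θ t : ℂ) * Complex.I)}

/-- The weak closure of `GammaStar` in `H¹([-T, T], ℂ)`. -/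
def Gamma (m α T φm φp : ℝ) : Set (H1Curve T) := weakClosure T (GammaStar m α T φm φp)

/-- The infimum of the action over `Gamma`. -/
def cbar (m α T φm φp : ℝ) : ℝ≥0∞ :=
  ⨅ x ∈ Gamma m α T φm φp, action m α T (x : ℝ → ℂ)

end Kepler

end

/-!
Existence is the direct method: bounded action bounds `‖ẋ‖` in `L²`, bounded sequences have weakly
convergent subsequences, and the action is weakly lower semicontinuous. A curve in `Gamma` without
collision lies in `GammaStar`, because weak convergence is uniform. Since
`|ẋ|² / 2 + m / (α |x|^α) ≥ √(2 m / α) |x|^(-α / 2) |ẋ|`, a curve with a collision has action at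
least `2 J`, where `J` is the Jacobi length, at zero energy, of the radial segment from the origin
to the end points, and equality holds for the collision-ejection solution. Two radial legs joined
by a circular arc of vanishing size show that the infimum over `GammaStar` is at most `2 J`.

If `(1 - α / 2) |φ₊ - φ₋| < π`, the infimum is less than `2 J`, so that minimizers have no
collision. Indeed `x ↦ x ^ (1 - α / 2)` turns the Jacobi metric into a multiple of the flat one and
the angle at the collision into one less than `π`, so that a straight chord is shorter than the two
radial legs through the origin.

On a time interval without collision, the first variation says that `ẍ = -m x / |x|^(α + 2)`
weakly. Testing with the difference of `x` and the function with this second derivative and the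
same end values shows that the two agree.
-/

noncomputable section

namespace Kepler

/-! ### Absolutely continuous curves -/

section AbsolutelyContinuous

variable {E : Type*} [NormedAddCommGroup E] {a b : ℝ}

theorem absCont_of_dist_le_mul {X Y : Type*} [PseudoMetricSpace X] [PseudoMetricSpace Y]
    {f : ℝ → X} {g : ℝ → Y} (hg : AbsolutelyContinuousOnInterval g a b) (K : ℝ)
    (h : ∀ s ∈ uIcc a b, ∀ t ∈ uIcc a b, dist (f s) (f t) ≤ K * dist (g s) (g t)) :
    AbsolutelyContinuousOnInterval f a b := by
  unfold AbsolutelyContinuousOnInterval at hg ⊢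
  refine squeeze_zero' (Eventually.of_forall fun _ => Finset.sum_nonneg fun _ _ => dist_nonneg) ?_
    (by simpa only [mul_zero] using hg.const_mul K)
  rw [eventually_inf_principal]
  filter_upwards with I hI
  rw [Finset.mul_sum]
  exact Finset.sum_le_sum fun i hi => h _ (hI.1 i hi).1 _ (hI.1 i hi).2

theorem absCont_congr {X : Type*} [PseudoMetricSpace X] {f g : ℝ → X}
    (hf : AbsolutelyContinuousOnInterval f a b) (h : EqOn g f (uIcc a b)) :
    AbsolutelyContinuousOnInterval g a b :=
  absCont_of_dist_le_mul hf 1 fun s hs t ht => by rw [h hs, h ht, one_mul]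

variable [NormedSpace ℝ E]

theorem absCont_integral {v : ℝ → E} (hv : IntervalIntegrable v volume a b) :
    AbsolutelyContinuousOnInterval (fun t => ∫ u in a..t, v u) a b := by
  have hsub : ∀ t ∈ uIcc a b, IntervalIntegrable v volume a t := fun t ht =>
    hv.mono_set (uIcc_subset_uIcc_left ht)
  refine absCont_of_dist_le_mul
    (hv.norm.absolutelyContinuousOnInterval_intervalIntegral (c := a) left_mem_uIcc) 1
    fun s hs t ht => ?_
  rw [dist_eq_norm, dist_eq_norm, one_mul,
    intervalIntegral.integral_interval_sub_left (hsub s hs) (hsub t ht),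
    intervalIntegral.integral_interval_sub_left (hsub s hs).norm (hsub t ht).norm]
  exact intervalIntegral.norm_integral_le_abs_integral_norm

theorem ae_differentiableAt_of_absCont_uIcc [FiniteDimensional ℝ E] {f : ℝ → E}
    (hf : AbsolutelyContinuousOnInterval f a b) :
    ∀ᵐ t : ℝ, t ∈ uIcc a b → DifferentiableAt ℝ f t := by
  filter_upwards [hf.boundedVariationOn.locallyBoundedVariationOn.ae_differentiableWithinAt_of_mem,
    compl_mem_ae_iff.2 (measure_singleton (min a b)),
    compl_mem_ae_iff.2 (measure_singleton (max a b))] with t ht hmin hmax htI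
  exact (ht htI).differentiableAt
    (Icc_mem_nhds (lt_of_le_of_ne htI.1 (Ne.symm hmin)) (lt_of_le_of_ne htI.2 hmax))

theorem integral_deriv_eq_sub_of_absCont [FiniteDimensional ℝ E] {f : ℝ → E}
    (hf : AbsolutelyContinuousOnInterval f a b)
    (hi : IntervalIntegrable (deriv f) volume a b) :
    ∫ t in a..b, deriv f t = f b - f a := by
  obtain ⟨C, hC⟩ := (hf.sub (absCont_integral hi)).const_of_ae_hasDerivAt_zero (by
    filter_upwards [ae_differentiableAt_of_absCont_uIcc hf, hi.ae_hasDerivAt_integral]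
      with t hft hIt ht
    simpa only [sub_self] using (hft ht).hasDerivAt.sub (hIt ht a left_mem_uIcc))
  have hconst := (hC b right_mem_uIcc).trans (hC a left_mem_uIcc).symm
  simp only [Pi.sub_apply, intervalIntegral.integral_same, sub_zero] at hconst
  rw [← hconst, sub_sub_cancel]

theorem integral_deriv_mul_add_mul_deriv {f g : ℝ → ℂ}
    (hf : AbsolutelyContinuousOnInterval f a b) (hg : AbsolutelyContinuousOnInterval g a b)
    (hf' : IntervalIntegrable (deriv f) volume a b)
    (hg' : IntervalIntegrable (deriv g) volume a b) :
    ∫ t in a..b, (deriv f t * g t + f t * deriv g t) = f b * g b - f a * g a := by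
  have hderiv : ∀ᵐ t : ℝ, t ∈ uIoc a b → deriv f t * g t + f t * deriv g t = deriv (f • g) t := by
    filter_upwards [ae_differentiableAt_of_absCont_uIcc hf, ae_differentiableAt_of_absCont_uIcc hg]
      with t hft hgt ht
    exact (deriv_mul (hft (uIoc_subset_uIcc ht)) (hgt (uIoc_subset_uIcc ht))).symm
  have hint : IntervalIntegrable (deriv (f • g)) volume a b :=
    ((hf'.mul_continuousOn hg.continuousOn).add (hg'.continuousOn_mul hf.continuousOn)).congr_ae
      ((ae_restrict_iff' measurableSet_uIoc).2 hderiv)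
  rw [intervalIntegral.integral_congr_ae hderiv,
    integral_deriv_eq_sub_of_absCont (hf.smul hg) hint]
  rfl

end AbsolutelyContinuous

theorem intervalIntegrable_of_memLp_two {T : ℝ} {v : ℝ → ℂ} (hv : MemLp v 2 (timeMeasure T))
    {a b : ℝ} (ha : a ∈ Icc (-T) T) (hb : b ∈ Icc (-T) T) : IntervalIntegrable v volume a b := by
  have h : IntegrableOn v (Icc (-T) T) volume := hv.integrable (by norm_num)
  exact intervalIntegrable_iff.2 (h.mono_set (uIoc_subset_uIcc.trans (uIcc_subset_Icc ha hb)))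

theorem MemH1.continuousOn {T : ℝ} {x : ℝ → ℂ} (hx : MemH1 T x) : ContinuousOn x (Icc (-T) T) :=
  hx.absCont.continuousOn.mono Icc_subset_uIcc

theorem MemH1.sub_eq_integral {T : ℝ} {x : ℝ → ℂ} (hx : MemH1 T x) {a b : ℝ}
    (ha : a ∈ Icc (-T) T) (hb : b ∈ Icc (-T) T) : ∫ t in a..b, deriv x t = x b - x a :=
  integral_deriv_eq_sub_of_absCont
    (hx.absCont.mono ((uIcc_subset_Icc ha hb).trans Icc_subset_uIcc))
    (intervalIntegrable_of_memLp_two hx.memLp_deriv ha hb)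

theorem memLp_two_of_continuousOn {T : ℝ} {f : ℝ → ℂ} (hf : ContinuousOn f (Icc (-T) T)) :
    MemLp f 2 (timeMeasure T) := by
  obtain ⟨C, hC⟩ := isCompact_Icc.exists_bound_of_continuousOn hf
  exact MemLp.of_bound (hf.aestronglyMeasurable measurableSet_Icc) C
    ((ae_restrict_iff' measurableSet_Icc).2 (ae_of_all _ hC))

theorem ae_timeMeasure_mem_Ioo (T : ℝ) : ∀ᵐ t ∂(timeMeasure T), t ∈ Ioo (-T) T := by
  rw [timeMeasure, ← Measure.restrict_congr_set Ioo_ae_eq_Icc]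
  exact ae_restrict_mem measurableSet_Ioo

theorem deriv_ae_eq_of_eq_integral {T : ℝ} {x v : ℝ → ℂ} {c : ℂ}
    (hv : MemLp v 2 (timeMeasure T)) (hx : ∀ t ∈ Icc (-T) T, x t = c + ∫ u in (-T)..t, v u) :
    deriv x =ᵐ[timeMeasure T] v := by
  rcases lt_or_ge T (-T) with hT | hT
  · simp [timeMeasure, hT, Filter.EventuallyEq]
  have hi := intervalIntegrable_of_memLp_two hv (left_mem_Icc.2 hT) (right_mem_Icc.2 hT)
  filter_upwards [ae_restrict_of_ae hi.ae_hasDerivAt_integral, ae_timeMeasure_mem_Ioo T]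
    with t ht htI
  refine HasDerivAt.deriv (((ht (Icc_subset_uIcc (Ioo_subset_Icc_self htI)) (-T)
    left_mem_uIcc).const_add c).congr_of_eventuallyEq ?_)
  filter_upwards [Icc_mem_nhds htI.1 htI.2] with u hu using hx u hu

theorem memH1_of_eq_integral {T : ℝ} (hT : 0 < T) {x v : ℝ → ℂ} {c : ℂ}
    (hv : MemLp v 2 (timeMeasure T)) (hx : ∀ t ∈ Icc (-T) T, x t = c + ∫ u in (-T)..t, v u) :
    MemH1 T x := by
  have hle : -T ≤ T := by linarith
  have hi := intervalIntegrable_of_memLp_two hv (left_mem_Icc.2 hle) (right_mem_Icc.2 hle)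
  have hc : AbsolutelyContinuousOnInterval (fun _ : ℝ => c) (-T) T :=
    ContDiffOn.absolutelyContinuousOnInterval contDiffOn_const
  refine ⟨absCont_congr (hc.add (absCont_integral hi)) fun t ht => ?_,
    hv.ae_eq (deriv_ae_eq_of_eq_integral hv hx).symm⟩
  exact hx t (uIcc_of_le hle ▸ ht)

theorem memH1_of_energy {T : ℝ} (hT : 0 < T) {x : ℝ → ℂ} {s : Set ℝ} (hs : s.Countable)
    (hx : ContinuousOn x (Icc (-T) T)) (hd : ∀ t ∈ Ioo (-T) T \ s, DifferentiableAt ℝ x t)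
    (he : ∫⁻ t in Icc (-T) T, ENNReal.ofReal (‖deriv x t‖ ^ 2 / 2) ≠ ⊤) : MemH1 T x := by
  have hle : -T ≤ T := by linarith
  have hv : MemLp (deriv x) 2 (timeMeasure T) := by
    rw [memLp_two_iff_integrable_sq_norm (stronglyMeasurable_deriv x).aestronglyMeasurable]
    have h : Integrable (fun t => ‖deriv x t‖ ^ 2 / 2) (timeMeasure T) := by
      refine (lintegral_ofReal_ne_top_iff_integrable ?_ (ae_of_all _ fun t => by positivity)).1 he
      exact (((measurable_deriv x).norm.pow_const 2).div_const 2).aestronglyMeasurable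
    simpa using h.mul_const 2
  refine memH1_of_eq_integral hT (c := x (-T)) hv fun t ht => ?_
  have hFTC := integral_eq_of_hasDerivAt_off_countable x (deriv x) hs
    (hx.mono (uIcc_of_le ht.1 ▸ Icc_subset_Icc_right ht.2)) (fun u hu => by
      rw [min_eq_left ht.1, max_eq_right ht.1] at hu
      exact (hd u ⟨Ioo_subset_Ioo_right ht.2 hu.1, hu.2⟩).hasDerivAt)
    (intervalIntegrable_of_memLp_two hv (left_mem_Icc.2 hle) ht)
  rw [hFTC, add_sub_cancel]

/-! ### Weak convergence in `H¹` -/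

/-- The position of an `H¹` curve, as an element of `L²`. -/
def pos {T : ℝ} (x : H1Curve T) : L2 T := MemLp.toLp _ (MemH1.memLp x.2)

/-- The velocity of an `H¹` curve, as an element of `L²`. -/
def vel {T : ℝ} (x : H1Curve T) : L2 T := MemLp.toLp _ x.2.memLp_deriv

section WeakConvergence

variable {T : ℝ} {x : ℕ → H1Curve T} {y : H1Curve T}

theorem coeFn_pos (x : H1Curve T) : pos x =ᵐ[timeMeasure T] (x : ℝ → ℂ) :=
  MemLp.coeFn_toLp _

theorem coeFn_vel (x : H1Curve T) : vel x =ᵐ[timeMeasure T] deriv (x : ℝ → ℂ) :=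
  MemLp.coeFn_toLp _

theorem weaklyTendsto_iff_dual :
    WeaklyTendsto T x y ↔ ∀ l : StrongDual ℂ (H1 T),
      Tendsto (fun n => l (toH1 T (x n))) atTop (𝓝 (l (toH1 T y))) := by
  have hinj : Function.Injective (topDualPairing ℂ (H1 T)).flip := by
    refine (injective_iff_map_eq_zero _).2 fun a ha => ?_
    exact SeparatingDual.eq_zero_of_forall_dual_eq_zero (R := ℂ) fun g => DFunLike.congr_fun ha g
  exact WeakBilin.tendsto_iff_forall_eval_tendsto _ hinj

theorem weaklyTendsto_iff :
    WeaklyTendsto T x y ↔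
      (∀ g : L2 T, Tendsto (fun n => inner ℂ g (pos (x n))) atTop (𝓝 (inner ℂ g (pos y)))) ∧
      ∀ g : L2 T, Tendsto (fun n => inner ℂ g (vel (x n))) atTop (𝓝 (inner ℂ g (vel y))) := by
  rw [weaklyTendsto_iff_dual]
  constructor
  · intro h
    exact ⟨fun g => h (innerSL ℂ g ∘L WithLp.fstL 2 ℂ (L2 T) (L2 T) ∘L (H1 T).subtypeL),
      fun g => h (innerSL ℂ g ∘L WithLp.sndL 2 ℂ (L2 T) (L2 T) ∘L (H1 T).subtypeL)⟩
  · rintro ⟨hpos, hvel⟩ l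
    obtain ⟨L, hL, -⟩ := exists_extension_norm_eq (H1 T) l
    obtain ⟨z, rfl⟩ := (InnerProductSpace.toDual ℂ (WithLp 2 (L2 T × L2 T))).surjective L
    have hl (w : H1Curve T) : l (toH1 T w) = inner ℂ z.fst (pos w) + inner ℂ z.snd (vel w) := by
      rw [← hL, InnerProductSpace.toDual_apply_apply, WithLp.prod_inner_apply]
      rfl
    simp only [hl]
    exact (hpos _).add (hvel _)

theorem exists_bound_of_tendsto_inner {H : Type*} [NormedAddCommGroup H] [InnerProductSpace ℂ H]
    [CompleteSpace H] {v : ℕ → H} {w : H}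
    (h : ∀ g : H, Tendsto (fun n => inner ℂ g (v n)) atTop (𝓝 (inner ℂ g w))) :
    ∃ M, ∀ n, ‖v n‖ ≤ M := by
  obtain ⟨M, hM⟩ := banach_steinhaus (g := fun n => innerSL ℂ (v n)) (fun g => by
    obtain ⟨C, hC⟩ := (h g).norm.bddAbove_range
    refine ⟨C, fun n => ?_⟩
    rw [innerSL_apply_apply, norm_inner_symm]
    exact hC ⟨n, rfl⟩)
  exact ⟨M, fun n => by simpa only [innerSL_apply_norm] using hM n⟩

theorem inner_indicator_vel (x : H1Curve T) {a b : ℝ} (ha : a ∈ Icc (-T) T)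
    (hb : b ∈ Icc (-T) T) (hab : a ≤ b) :
    inner ℂ (indicatorConstLp 2 (μ := timeMeasure T) (measurableSet_Ioc (a := a) (b := b))
      (measure_ne_top _ _) (1 : ℂ)) (vel x) = (x : ℝ → ℂ) b - (x : ℝ → ℂ) a := by
  have hsub : Ioc a b ⊆ Icc (-T) T := fun t ht => ⟨ha.1.trans ht.1.le, ht.2.trans hb.2⟩
  rw [L2.inner_indicatorConstLp_one, ← x.2.sub_eq_integral ha hb,
    intervalIntegral.integral_of_le hab,
    setIntegral_congr_ae measurableSet_Ioc ((coeFn_vel x).mono fun t ht _ => ht), timeMeasure,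
    Measure.restrict_restrict measurableSet_Ioc, inter_eq_left.2 hsub]

theorem norm_sub_le_sqrt (x : H1Curve T) {a b : ℝ} (ha : a ∈ Icc (-T) T)
    (hb : b ∈ Icc (-T) T) :
    ‖(x : ℝ → ℂ) b - (x : ℝ → ℂ) a‖ ≤ √|b - a| * ‖vel x‖ := by
  wlog hab : a ≤ b generalizing a b
  · rw [norm_sub_rev, abs_sub_comm]
    exact this hb ha (le_of_not_ge hab)
  have hsub : Ioc a b ⊆ Icc (-T) T := fun t ht => ⟨ha.1.trans ht.1.le, ht.2.trans hb.2⟩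
  have hmeas : (timeMeasure T).real (Ioc a b) = |b - a| := by
    rw [timeMeasure, measureReal_restrict_apply measurableSet_Ioc, inter_eq_left.2 hsub,
      Real.volume_real_Ioc_of_le hab, abs_of_nonneg (sub_nonneg.2 hab)]
  rw [← inner_indicator_vel x ha hb hab]
  refine (norm_inner_le_norm _ _).trans (mul_le_mul_of_nonneg_right ?_ (norm_nonneg _))
  rw [norm_indicatorConstLp (by norm_num) (by norm_num), hmeas, Real.sqrt_eq_rpow]
  simp

theorem tendstoUniformlyOn_of_tendsto {M : ℝ} (hM : ∀ n, ‖vel (x n)‖ ≤ M) {y : ℝ → ℂ}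
    (h : ∀ t ∈ Icc (-T) T, Tendsto (fun n => (x n : ℝ → ℂ) t) atTop (𝓝 (y t))) :
    TendstoUniformlyOn (fun n => (x n : ℝ → ℂ)) y atTop (Icc (-T) T) := by
  have hequi : Equicontinuous (fun n => (Icc (-T) T).domRestrict (x n : ℝ → ℂ)) := by
    refine Metric.equicontinuous_of_continuity_modulus (fun d => √d * M) ?_ _ fun s t n => ?_
    · simpa using (show Continuous fun d : ℝ => √d * M by fun_prop).tendsto 0
    · rw [dist_comm, dist_eq_norm, dist_comm, Subtype.dist_eq, Real.dist_eq]
      exact (norm_sub_le_sqrt (x n) s.2 t.2).trans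
        (mul_le_mul_of_nonneg_left (hM n) (Real.sqrt_nonneg _))
  have hlim := (hequi.tendsto_uniformFun_iff_pi atTop ((Icc (-T) T).domRestrict y)).2
    (tendsto_pi_nhds.2 fun t => h t t.2)
  rw [UniformFun.tendsto_iff_tendstoUniformly] at hlim
  exact tendstoUniformlyOn_iff_restrict.2 hlim

theorem tendsto_apply (hleft : Tendsto (fun n => (x n : ℝ → ℂ) (-T)) atTop (𝓝 ((y : ℝ → ℂ) (-T))))
    (hvel : ∀ g : L2 T, Tendsto (fun n => inner ℂ g (vel (x n))) atTop (𝓝 (inner ℂ g (vel y))))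
    {t : ℝ} (ht : t ∈ Icc (-T) T) :
    Tendsto (fun n => (x n : ℝ → ℂ) t) atTop (𝓝 ((y : ℝ → ℂ) t)) := by
  have hl : -T ∈ Icc (-T) T := ⟨le_rfl, ht.1.trans ht.2⟩
  have hsub := hvel (indicatorConstLp 2 (μ := timeMeasure T) (measurableSet_Ioc (a := -T) (b := t))
      (measure_ne_top _ _) (1 : ℂ))
  simp only [inner_indicator_vel _ hl ht ht.1] at hsub
  simpa only [sub_add_cancel] using hsub.add hleft

-- Integration by parts against a multiple of `t ↦ t - T`, which vanishes at the right end point,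
-- makes the evaluation at the left end point a bounded functional of the jet.
theorem exists_inner_eq_apply_left (hT : 0 < T) :
    ∃ g h : L2 T, ∀ x : H1Curve T,
      (x : ℝ → ℂ) (-T) = inner ℂ g (pos x) + inner ℂ h (vel x) := by
  have hle : -T ≤ T := by linarith
  let k : ℝ → ℂ := fun t => (((t - T) / (2 * T) : ℝ) : ℂ)
  have hk' : ∀ t, HasDerivAt k ((1 / (2 * T) : ℝ) : ℂ) t := fun t =>
    (((hasDerivAt_id t).sub_const T).div_const _).ofReal_comp
  have hkc : ContinuousOn k (Icc (-T) T) := fun t _ => (hk' t).continuousAt.continuousWithinAt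
  have hk : AbsolutelyContinuousOnInterval k (-T) T :=
    ContDiffOn.absolutelyContinuousOnInterval
      (Complex.ofRealCLM.contDiff.comp ((contDiff_id.sub contDiff_const).div_const _)).contDiffOn
  have hcL : MemLp (fun _ : ℝ => ((1 / (2 * T) : ℝ) : ℂ)) 2 (timeMeasure T) := memLp_const _
  refine ⟨hcL.toLp, (memLp_two_of_continuousOn hkc).toLp, fun x => ?_⟩
  have hparts := integral_deriv_mul_add_mul_deriv hk x.2.absCont
    (by simp only [funext fun t => (hk' t).deriv]; exact intervalIntegrable_const)
    (intervalIntegrable_of_memLp_two x.2.memLp_deriv (left_mem_Icc.2 hle) (right_mem_Icc.2 hle))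
  have hends : k T * (x : ℝ → ℂ) T - k (-T) * (x : ℝ → ℂ) (-T) = (x : ℝ → ℂ) (-T) := by
    have hkl : k (-T) = -1 := by
      simp only [k, show (-T - T) / (2 * T) = -1 by field_simp; ring, Complex.ofReal_neg,
        Complex.ofReal_one]
    have hkr : k T = 0 := by simp [k]
    rw [hkl, hkr]
    ring
  rw [← hends, ← hparts, L2.inner_def, L2.inner_def,
    ← integral_add (L2.integrable_inner _ _) (L2.integrable_inner _ _),
    intervalIntegral.integral_of_le hle, ← integral_Icc_eq_integral_Ioc]
  refine integral_congr_ae ?_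
  filter_upwards [hcL.coeFn_toLp, (memLp_two_of_continuousOn hkc).coeFn_toLp, coeFn_pos x,
    coeFn_vel x] with t hg hh hpos hvel
  rw [hg, hh, hpos, hvel, (hk' t).deriv, RCLike.inner_apply', RCLike.inner_apply']
  simp only [k, Complex.conj_ofReal]

theorem tendsto_pos_of_tendstoUniformlyOn
    (h : TendstoUniformlyOn (fun n => (x n : ℝ → ℂ)) y atTop (Icc (-T) T)) :
    Tendsto (fun n => pos (x n)) atTop (𝓝 (pos y)) := by
  refine Metric.tendsto_atTop'.2 fun ε hε => ?_
  let K := measureUnivNNReal (timeMeasure T) ^ (2 : ℝ≥0∞).toReal⁻¹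
  have hδ : 0 < ε / (K + 1) := by positivity
  obtain ⟨N, hN⟩ := eventually_atTop.1 (Metric.tendstoUniformlyOn_iff.1 h _ hδ)
  refine ⟨N, fun n hn => ?_⟩
  have hle : ‖pos (x n) - pos y‖ ≤ K * (ε / (K + 1)) := by
    refine Lp.norm_le_of_ae_bound hδ.le ?_
    filter_upwards [Lp.coeFn_sub (pos (x n)) (pos y), coeFn_pos (x n), coeFn_pos y,
      ae_restrict_mem measurableSet_Icc] with t hsub hxt hyt ht
    rw [hsub, Pi.sub_apply, hxt, hyt, ← dist_eq_norm, dist_comm]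
    exact (hN n hn.le t ht).le
  rw [dist_eq_norm]
  refine hle.trans_lt ?_
  rw [mul_div_assoc', div_lt_iff₀ (by positivity)]
  nlinarith

theorem weaklyTendsto_iff_tendsto_left (hT : 0 < T) :
    WeaklyTendsto T x y ↔
      Tendsto (fun n => (x n : ℝ → ℂ) (-T)) atTop (𝓝 ((y : ℝ → ℂ) (-T))) ∧
      ∀ g : L2 T, Tendsto (fun n => inner ℂ g (vel (x n))) atTop (𝓝 (inner ℂ g (vel y))) := by
  rw [weaklyTendsto_iff]
  constructor
  · rintro ⟨hpos, hvel⟩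
    obtain ⟨g, h, hgh⟩ := exists_inner_eq_apply_left hT
    simp only [hgh]
    exact ⟨(hpos g).add (hvel h), hvel⟩
  · rintro ⟨hleft, hvel⟩
    obtain ⟨M, hM⟩ := exists_bound_of_tendsto_inner hvel
    exact ⟨fun g => tendsto_const_nhds.inner (tendsto_pos_of_tendstoUniformlyOn
      (tendstoUniformlyOn_of_tendsto hM fun t ht => tendsto_apply hleft hvel ht)), hvel⟩

theorem WeaklyTendsto.tendstoUniformlyOn (h : WeaklyTendsto T x y) (hT : 0 < T) :
    TendstoUniformlyOn (fun n => (x n : ℝ → ℂ)) y atTop (Icc (-T) T) := by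
  obtain ⟨hleft, hvel⟩ := (weaklyTendsto_iff_tendsto_left hT).1 h
  obtain ⟨M, hM⟩ := exists_bound_of_tendsto_inner hvel
  exact tendstoUniformlyOn_of_tendsto hM fun t ht => tendsto_apply hleft hvel ht

theorem exists_subseq_tendsto_inner {H : Type*} [NormedAddCommGroup H] [InnerProductSpace ℂ H]
    [CompleteSpace H] [TopologicalSpace.SeparableSpace H] {M : ℝ} {v : ℕ → H}
    (hM : ∀ n, ‖v n‖ ≤ M) :
    ∃ (w : H) (φ : ℕ → ℕ), StrictMono φ ∧
      ∀ g : H, Tendsto (fun n => inner ℂ g (v (φ n))) atTop (𝓝 (inner ℂ g w)) := by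
  obtain ⟨f, -, φ, hφ, hf⟩ := WeakDual.isSeqCompact_closedBall ℂ H 0 M
    (x := fun n => StrongDual.toWeakDual (InnerProductSpace.toDual ℂ H (v n)))
    (fun n => by simpa using hM n)
  obtain ⟨w, hw⟩ := (InnerProductSpace.toDual ℂ H).surjective (WeakDual.toStrongDual f)
  refine ⟨w, φ, hφ, fun g => ?_⟩
  rw [tendsto_iff_forall_eval_tendsto_topDualPairing] at hf
  have hfg : Tendsto (fun n => inner ℂ (v (φ n)) g) atTop (𝓝 (inner ℂ w g)) := by
    rw [← InnerProductSpace.toDual_apply_apply, hw]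
    exact hf g
  simpa only [Function.comp_def, inner_conj_symm] using (Complex.continuous_conj.tendsto _).comp hfg

theorem exists_subseq_weaklyTendsto (hT : 0 < T) {M : ℝ} (hM : ∀ n, ‖vel (x n)‖ ≤ M) {p : ℂ}
    (hp : ∀ n, (x n : ℝ → ℂ) (-T) = p) :
    ∃ (y : H1Curve T) (φ : ℕ → ℕ), StrictMono φ ∧ WeaklyTendsto T (x ∘ φ) y := by
  have : Fact ((2 : ℝ≥0∞) ≠ ⊤) := ⟨by norm_num⟩
  obtain ⟨w, φ, hφ, hw⟩ := exists_subseq_tendsto_inner hM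
  let y : H1Curve T := ⟨fun t => p + ∫ u in (-T)..t, w u,
    memH1_of_eq_integral hT (Lp.memLp w) fun _ _ => rfl⟩
  have hvel : vel y = w :=
    Lp.ext ((coeFn_vel y).trans (deriv_ae_eq_of_eq_integral (Lp.memLp w) fun _ _ => rfl))
  have hy : (y : ℝ → ℂ) (-T) = p := by simp [y]
  exact ⟨y, φ, hφ, (weaklyTendsto_iff_tendsto_left hT).2
    ⟨by simp only [Function.comp_apply, hp, hy, tendsto_const_nhds], hvel ▸ hw⟩⟩

end WeakConvergence

/-! ### Lower semicontinuity of the action -/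

section LowerSemicontinuity

variable {T : ℝ} {x : ℕ → H1Curve T} {y : H1Curve T}

theorem norm_vel_sq (x : H1Curve T) :
    ‖vel x‖ ^ 2 = ∫ t in Icc (-T) T, ‖deriv (x : ℝ → ℂ) t‖ ^ 2 := by
  have hinner : ((‖vel x‖ ^ 2 : ℝ) : ℂ) =
      ∫ t in Icc (-T) T, ((‖deriv (x : ℝ → ℂ) t‖ ^ 2 : ℝ) : ℂ) := by
    rw [Complex.ofReal_pow]
    refine (inner_self_eq_norm_sq_to_K (𝕜 := ℂ) (vel x)).symm.trans (integral_congr_ae ?_)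
    filter_upwards [coeFn_vel x] with t ht
    rw [ht, inner_self_eq_norm_sq_to_K]
    simp
  rw [integral_complex_ofReal] at hinner
  exact_mod_cast hinner

theorem lintegral_kinetic (x : H1Curve T) :
    ∫⁻ t in Icc (-T) T, ENNReal.ofReal (‖deriv (x : ℝ → ℂ) t‖ ^ 2 / 2) =
      ENNReal.ofReal (‖vel x‖ ^ 2 / 2) := by
  rw [norm_vel_sq, ← integral_div, ofReal_integral_eq_lintegral_ofReal]
  · exact (x.2.memLp_deriv.integrable_norm_pow (by norm_num)).div_const 2
  · exact ae_of_all _ fun t => by positivity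

theorem continuous_potential (m α : ℝ) : Continuous (potential m α) :=
  continuous_iff_continuousAt.2 fun _ => ENNReal.Tendsto.const_div
    (ENNReal.continuous_rpow_const.comp continuous_enorm).continuousAt
    (Or.inr ENNReal.ofReal_ne_top)

theorem action_eq {m α : ℝ} (x : H1Curve T) :
    action m α T x = ENNReal.ofReal (‖vel x‖ ^ 2 / 2) +
      ∫⁻ t in Icc (-T) T, potential m α ((x : ℝ → ℂ) t) := by
  rw [action, lintegral_add_left, lintegral_kinetic]
  exact (((measurable_deriv (x : ℝ → ℂ)).norm.pow_const 2).div_const 2).ennreal_ofReal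

theorem norm_vel_sq_le_liminf (h : WeaklyTendsto T x y) :
    ENNReal.ofReal (‖vel y‖ ^ 2 / 2) ≤
      liminf (fun n => ENNReal.ofReal (‖vel (x n)‖ ^ 2 / 2)) atTop := by
  have hself : (inner ℂ (vel y) (vel y) : ℂ).re = ‖vel y‖ ^ 2 :=
    inner_self_eq_norm_sq (𝕜 := ℂ) (vel y)
  have hre : Tendsto (fun n => (inner ℂ (vel y) (vel (x n)) : ℂ).re - ‖vel y‖ ^ 2 / 2) atTop
      (𝓝 (‖vel y‖ ^ 2 / 2)) := by
    have hlim := ((Complex.continuous_re.tendsto _).comp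
      ((weaklyTendsto_iff.1 h).2 (vel y))).sub_const (‖vel y‖ ^ 2 / 2)
    rwa [hself, sub_half] at hlim
  rw [← ((ENNReal.continuous_ofReal.tendsto _).comp hre).liminf_eq]
  refine liminf_le_liminf (Eventually.of_forall fun n => ENNReal.ofReal_le_ofReal ?_)
  have hcs : (inner ℂ (vel y) (vel (x n)) : ℂ).re ≤ ‖vel y‖ * ‖vel (x n)‖ :=
    (Complex.re_le_norm _).trans (norm_inner_le_norm _ _)
  linarith [two_mul_le_add_sq ‖vel y‖ ‖vel (x n)‖]

theorem ennreal_liminf_add_liminf_le {ι : Type*} {l : Filter ι} (f g : ι → ℝ≥0∞) :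
    liminf f l + liminf g l ≤ liminf (fun i => f i + g i) l := by
  rw [liminf_eq_iSup_iInf, liminf_eq_iSup_iInf]
  refine ENNReal.biSup_add_biSup_le' ⟨univ, univ_mem⟩ ⟨univ, univ_mem⟩ fun s hs t ht => ?_
  refine le_liminf_of_le (by isBoundedDefault) ?_
  filter_upwards [hs, ht] with i hi hi' using add_le_add (iInf₂_le i hi) (iInf₂_le i hi')

theorem action_le_of_weaklyTendsto {m α : ℝ} (hT : 0 < T) (h : WeaklyTendsto T x y) {c : ℝ≥0∞}
    (hc : Tendsto (fun n => action m α T (x n)) atTop (𝓝 c)) : action m α T y ≤ c := by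
  have hpot : ∫⁻ t in Icc (-T) T, potential m α ((y : ℝ → ℂ) t) ≤
      liminf (fun n => ∫⁻ t in Icc (-T) T, potential m α ((x n : ℝ → ℂ) t)) atTop := by
    refine le_trans (lintegral_mono_ae ?_) (lintegral_liminf_le' fun n =>
      (continuous_potential m α).measurable.comp_aemeasurable
        (MemH1.memLp (x n).2).aestronglyMeasurable.aemeasurable)
    filter_upwards [ae_restrict_mem measurableSet_Icc] with t ht
    exact (((continuous_potential m α).tendsto _).comp
      ((h.tendstoUniformlyOn hT).tendsto_at ht)).liminf_eq.ge
  calc action m α T y ≤ _ := (action_eq y).trans_le (add_le_add (norm_vel_sq_le_liminf h) hpot)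
    _ ≤ liminf (fun n => action m α T (x n)) atTop := by
      simp only [action_eq]
      exact ennreal_liminf_add_liminf_le _ _
    _ = c := hc.liminf_eq

end LowerSemicontinuity

/-! ### The classes `GammaStar` and `Gamma` -/

theorem norm_mul_exp_add_arg_div {z w : ℂ} {θ : ℝ} (hz0 : z ≠ 0)
    (hz : z = ‖z‖ * Complex.exp (θ * Complex.I)) :
    w = ‖w‖ * Complex.exp ((θ + Complex.arg (w / z) : ℝ) * Complex.I) := by
  have hn : (‖z‖ : ℂ) ≠ 0 := by exact_mod_cast norm_ne_zero_iff.2 hz0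
  have hdiv := Complex.norm_mul_exp_arg_mul_I (w / z)
  rw [norm_div, Complex.ofReal_div] at hdiv
  rw [Complex.ofReal_add, add_mul, Complex.exp_add]
  calc w = z * (w / z) := by field_simp
    _ = (‖z‖ * Complex.exp (θ * Complex.I)) *
        ((‖w‖ : ℂ) / ‖z‖ * Complex.exp (Complex.arg (w / z) * Complex.I)) := by rw [hdiv, ← hz]
    _ = _ := by field_simp

theorem continuousOn_arg_div {X : Type*} [TopologicalSpace X] {s : Set X} {f g : X → ℂ}
    (hf : ContinuousOn f s) (hg : ContinuousOn g s) (h : ∀ t ∈ s, ‖g t - f t‖ < ‖f t‖) :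
    ContinuousOn (fun t => Complex.arg (g t / f t)) s := by
  have hf0 : ∀ t ∈ s, f t ≠ 0 := fun t ht => norm_pos_iff.1 ((norm_nonneg _).trans_lt (h t ht))
  refine fun t ht => ContinuousAt.comp_continuousWithinAt (f := fun t => g t / f t)
    (Complex.continuousAt_arg ?_) ((hg.div hf hf0) t ht)
  rw [← add_sub_cancel (1 : ℂ) (g t / f t)]
  refine Complex.mem_slitPlane_of_norm_lt_one ?_
  rw [div_sub_one (hf0 t ht), norm_div, div_lt_one (norm_pos_iff.2 (hf0 t ht))]
  exact h t ht

section Gamma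

variable {m α T φm φp : ℝ}

theorem mem_GammaStar_of_norm_sub_lt {x y : H1Curve T}
    (hx : x ∈ GammaStar m α T φm φp) (hl : (y : ℝ → ℂ) (-T) = (x : ℝ → ℂ) (-T))
    (hr : (y : ℝ → ℂ) T = (x : ℝ → ℂ) T)
    (h : ∀ t ∈ Icc (-T) T, ‖(y : ℝ → ℂ) t - (x : ℝ → ℂ) t‖ < ‖(x : ℝ → ℂ) t‖) :
    y ∈ GammaStar m α T φm φp := by
  obtain ⟨hx0, hxl, hxr, θ, hθ, hθl, hθr, hθx⟩ := hx
  refine ⟨fun t ht hy0 => ?_, hl.trans hxl, hr.trans hxr,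
    fun t => θ t + Complex.arg ((y : ℝ → ℂ) t / (x : ℝ → ℂ) t),
    hθ.add (continuousOn_arg_div x.2.continuousOn y.2.continuousOn h), ?_, ?_,
    fun t ht => norm_mul_exp_add_arg_div (hx0 t ht) (hθx t ht)⟩
  · simpa [hy0] using h t ht
  · by_cases h0 : (x : ℝ → ℂ) (-T) = 0 <;> simp [hl, h0, hθl]
  · by_cases h0 : (x : ℝ → ℂ) T = 0 <;> simp [hr, h0, hθr]

theorem GammaStar_subset_Gamma : GammaStar m α T φm φp ⊆ Gamma m α T φm φp := fun x hx =>
  ⟨fun _ => x, fun _ => hx, weaklyTendsto_iff_dual.2 fun _ => tendsto_const_nhds⟩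

theorem apply_of_mem_Gamma (hT : 0 < T) {y : H1Curve T} (hy : y ∈ Gamma m α T φm φp) :
    (y : ℝ → ℂ) (-T) = xbar m α φm φp (-T) ∧ (y : ℝ → ℂ) T = xbar m α φm φp T := by
  obtain ⟨x, hx, hxy⟩ := hy
  have hTT : -T ≤ T := by linarith
  have hu := hxy.tendstoUniformlyOn hT
  refine ⟨tendsto_nhds_unique (hu.tendsto_at (left_mem_Icc.2 hTT)) ?_,
    tendsto_nhds_unique (hu.tendsto_at (right_mem_Icc.2 hTT)) ?_⟩
  · simp only [fun n => (hx n).2.1, tendsto_const_nhds]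
  · simp only [fun n => (hx n).2.2.1, tendsto_const_nhds]

theorem add_mem_Gamma (hT : 0 < T) {y z : H1Curve T}
    (hy : y ∈ Gamma m α T φm φp) (hl : (z : ℝ → ℂ) (-T) = 0) (hr : (z : ℝ → ℂ) T = 0) {δ : ℝ}
    (hδ : 0 < δ)
    (hz : ∀ t ∈ Icc (-T) T, (z : ℝ → ℂ) t = 0 ∨ ‖(z : ℝ → ℂ) t‖ + δ ≤ ‖(y : ℝ → ℂ) t‖) :
    y + z ∈ Gamma m α T φm φp := by
  obtain ⟨x, hx, hxy⟩ := hy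
  obtain ⟨N, hN⟩ := eventually_atTop.1
    (Metric.tendstoUniformlyOn_iff.1 (hxy.tendstoUniformlyOn hT) δ hδ)
  refine ⟨fun n => x (n + N) + z, fun n => ?_, weaklyTendsto_iff_dual.2 fun l => ?_⟩
  · refine mem_GammaStar_of_norm_sub_lt (hx (n + N)) (by simp [hl]) (by simp [hr]) fun t ht => ?_
    simp only [Submodule.coe_add, Pi.add_apply, add_sub_cancel_left]
    rcases hz t ht with hz0 | hzδ
    · rw [hz0, norm_zero]
      exact norm_pos_iff.2 ((hx (n + N)).1 t ht)
    · have hclose := hN (n + N) (Nat.le_add_left _ _) t ht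
      rw [dist_eq_norm] at hclose
      linarith [norm_le_norm_add_norm_sub' ((y : ℝ → ℂ) t) ((x (n + N) : ℝ → ℂ) t)]
  · simp only [map_add]
    exact ((tendsto_add_atTop_iff_nat N).2 (weaklyTendsto_iff_dual.1 hxy l)).add_const _

theorem mem_GammaStar_of_mem_Gamma (hT : 0 < T) {y : H1Curve T}
    (hy : y ∈ Gamma m α T φm φp) (h0 : ∀ t ∈ Icc (-T) T, (y : ℝ → ℂ) t ≠ 0) :
    y ∈ GammaStar m α T φm φp := by
  obtain ⟨hyl, hyr⟩ := apply_of_mem_Gamma hT hy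
  obtain ⟨x, hx, hxy⟩ := hy
  obtain ⟨δ, hδ, hδy⟩ := isCompact_Icc.exists_forall_le' y.2.continuousOn.norm
    fun t ht => norm_pos_iff.2 (h0 t ht)
  obtain ⟨N, hN⟩ :=
    (Metric.tendstoUniformlyOn_iff.1 (hxy.tendstoUniformlyOn hT) (δ / 2) (half_pos hδ)).exists
  refine mem_GammaStar_of_norm_sub_lt (hx N) (hyl.trans (hx N).2.1.symm)
    (hyr.trans (hx N).2.2.1.symm) fun t ht => ?_
  have hclose := hN t ht
  rw [dist_eq_norm] at hclose
  linarith [hδy t ht, norm_le_norm_add_norm_sub' ((y : ℝ → ℂ) t) ((x N : ℝ → ℂ) t)]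

end Gamma

/-! ### The lower bound for curves with collisions -/

/-- The Lagrangian `|ẋ|² / 2 + m / (α |x|^α)` along a curve: the integrand of `action`. -/
def lagrangian (m α : ℝ) (x : ℝ → ℂ) (t : ℝ) : ℝ≥0∞ :=
  ENNReal.ofReal (‖deriv x t‖ ^ 2 / 2) + potential m α (x t)

/-- The Jacobi length, at zero energy, of the radial segment from the origin to radius `r`. -/
def jacobi (m α r : ℝ) : ℝ := √(2 * m / α) / (1 - α / 2) * r ^ (1 - α / 2)

section LowerBound

variable {m α : ℝ}

theorem lintegral_Ioo_lagrangian_add_le_action {T t₀ : ℝ} {x : ℝ → ℂ} (ht₀ : t₀ ∈ Icc (-T) T) :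
    (∫⁻ t in Ioo (-T) t₀, lagrangian m α x t) + ∫⁻ t in Ioo t₀ T, lagrangian m α x t ≤
      action m α T x := by
  rw [← lintegral_union measurableSet_Ioo]
  · exact lintegral_mono_set (union_subset (fun t ht => ⟨ht.1.le, ht.2.le.trans ht₀.2⟩)
      fun t ht => ⟨ht₀.1.trans ht.1.le, ht.2.le⟩)
  · exact disjoint_left.2 fun t ht ht' => lt_asymm ht.2 ht'.1

theorem potential_eq_ofReal {z : ℂ} (hz : z ≠ 0) :
    potential m α z = ENNReal.ofReal (m / α / ‖z‖ ^ α) := by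
  have hpos : 0 < ‖z‖ := norm_pos_iff.2 hz
  rw [potential, ENNReal.ofReal_div_of_pos (Real.rpow_pos_of_pos hpos _),
    ← ENNReal.ofReal_rpow_of_pos hpos, ofReal_norm]

theorem ofReal_le_potential (hα : 0 < α) {z : ℂ} {ρ : ℝ} (hρ : 0 < ρ)
    (hz : ‖z‖ ≤ ρ) : ENNReal.ofReal (m / α / ρ ^ α) ≤ potential m α z := by
  rw [potential, ENNReal.ofReal_div_of_pos (by positivity), ← ENNReal.ofReal_rpow_of_pos hρ]
  gcongr
  exact ofReal_norm z ▸ ENNReal.ofReal_le_ofReal hz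

theorem jacobi_zero (hα2 : α < 2) : jacobi m α 0 = 0 := by
  rw [jacobi, Real.zero_rpow (by linarith), mul_zero]

theorem jacobi_le_jacobi (hα2 : α < 2) {r s : ℝ} (hr : 0 ≤ r) (hrs : r ≤ s) :
    jacobi m α r ≤ jacobi m α s := by
  have h : 0 < 1 - α / 2 := by linarith
  unfold jacobi
  gcongr

theorem jacobi_nonneg (hα2 : α < 2) {r : ℝ} (hr : 0 ≤ r) : 0 ≤ jacobi m α r :=
  (jacobi_zero hα2).symm.trans_le (jacobi_le_jacobi hα2 le_rfl hr)

theorem jacobi_pos (hm : 0 < m) (hα : 0 < α) (hα2 : α < 2) {r : ℝ} (hr : 0 < r) :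
    0 < jacobi m α r := by
  have h : 0 < 1 - α / 2 := by linarith
  unfold jacobi
  positivity

theorem continuous_jacobi (hα2 : α < 2) : Continuous (jacobi m α) :=
  continuous_const.mul (Real.continuous_rpow_const (by linarith))

theorem hasDerivAt_jacobi (hα2 : α < 2) {r : ℝ} (hr : 0 < r) :
    HasDerivAt (jacobi m α) (√(2 * m / α) * r ^ (-(α / 2))) r := by
  refine ((Real.hasDerivAt_rpow_const (p := 1 - α / 2) (Or.inl hr.ne')).const_mul
    (√(2 * m / α) / (1 - α / 2))).congr_deriv ?_
  rw [show 1 - α / 2 - 1 = -(α / 2) by ring, ← mul_assoc, div_mul_cancel₀ _ (by linarith)]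

theorem sq_sqrt_mul_rpow (hm : 0 < m) (hα : 0 < α) {r : ℝ} (hr : 0 < r) :
    (√(2 * m / α) * r ^ (-(α / 2))) ^ 2 = 2 * (m / α / r ^ α) := by
  have h : (r ^ (-(α / 2))) ^ 2 = (r ^ α)⁻¹ := by
    rw [← Real.rpow_natCast, ← Real.rpow_mul hr.le, ← Real.rpow_neg hr.le]
    congr 1
    push_cast
    ring
  rw [mul_pow, Real.sq_sqrt (by positivity), h]
  ring

theorem sqrt_mul_rpow_mul_le (hm : 0 < m) (hα : 0 < α) {r : ℝ} (hr : 0 < r) (w : ℝ) :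
    √(2 * m / α) * r ^ (-(α / 2)) * w ≤ w ^ 2 / 2 + m / α / r ^ α := by
  linarith [two_mul_le_add_sq (√(2 * m / α) * r ^ (-(α / 2))) w, sq_sqrt_mul_rpow hm hα hr]

-- Replacing `‖z‖` by `√(‖z‖² + ε²)` smooths the Jacobi length at collisions.
theorem contDiff_jacobi_sqrt {ε : ℝ} (hε : 0 < ε) :
    ContDiff ℝ 1 fun z : ℂ => jacobi m α √(‖z‖ ^ 2 + ε ^ 2) := by
  have hpos : ∀ z : ℂ, ‖z‖ ^ 2 + ε ^ 2 ≠ 0 := fun z => by positivity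
  refine contDiff_const.mul (ContDiff.rpow_const_of_ne ?_ fun z =>
    Real.sqrt_ne_zero'.2 (by positivity))
  exact ((contDiff_norm_sq ℝ).add contDiff_const).sqrt hpos

theorem enorm_deriv_jacobi_sqrt_le (hm : 0 < m) (hα : 0 < α) (hα2 : α < 2) {f : ℝ → ℂ} {ε t : ℝ}
    (hε : 0 < ε) (hf : DifferentiableAt ℝ f t) :
    ‖deriv (fun t => jacobi m α √(‖f t‖ ^ 2 + ε ^ 2)) t‖ₑ ≤ lagrangian m α f t := by
  have hq : 0 < ‖f t‖ ^ 2 + ε ^ 2 := by positivity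
  obtain ⟨ρ, hρ⟩ : ∃ ρ, ρ = √(‖f t‖ ^ 2 + ε ^ 2) := ⟨_, rfl⟩
  have hρ0 : 0 < ρ := hρ ▸ Real.sqrt_pos.2 hq
  have hle : ‖f t‖ ≤ ρ := hρ ▸ Real.le_sqrt_of_sq_le (by nlinarith)
  have hρd := ((hf.hasDerivAt.norm_sq.add_const (ε ^ 2)).sqrt hq.ne')
  have hd := (hasDerivAt_jacobi (m := m) hα2 (Real.sqrt_pos.2 hq)).comp t hρd
  have hinner : |2 * inner ℝ (f t) (deriv f t) / (2 * ρ)| ≤ ‖deriv f t‖ := by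
    rw [mul_div_mul_left _ _ two_ne_zero, abs_div, abs_of_pos hρ0, div_le_iff₀ hρ0, mul_comm]
    exact (abs_real_inner_le_norm _ _).trans (by gcongr)
  calc ‖deriv (fun t => jacobi m α √(‖f t‖ ^ 2 + ε ^ 2)) t‖ₑ
      = ENNReal.ofReal (√(2 * m / α) * ρ ^ (-(α / 2)) *
          |2 * inner ℝ (f t) (deriv f t) / (2 * ρ)|) := by
        rw [show deriv (fun t => jacobi m α √(‖f t‖ ^ 2 + ε ^ 2)) t = _ from hd.deriv, ← hρ,
          ← ofReal_norm, Real.norm_eq_abs, abs_mul, abs_of_nonneg (by positivity)]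
    _ ≤ ENNReal.ofReal (√(2 * m / α) * ρ ^ (-(α / 2)) * ‖deriv f t‖) := by gcongr
    _ ≤ ENNReal.ofReal (‖deriv f t‖ ^ 2 / 2 + m / α / ρ ^ α) :=
        ENNReal.ofReal_le_ofReal (sqrt_mul_rpow_mul_le hm hα hρ0 _)
    _ ≤ lagrangian m α f t := by
        rw [ENNReal.ofReal_add (by positivity) (by positivity)]
        exact add_le_add_right (ofReal_le_potential hα hρ0 hle) _

theorem enorm_jacobi_sqrt_sub_le_lintegral (hm : 0 < m) (hα : 0 < α) (hα2 : α < 2) {f : ℝ → ℂ}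
    {a b ε : ℝ} (hab : a ≤ b) (hε : 0 < ε) (hf : AbsolutelyContinuousOnInterval f a b) :
    ‖jacobi m α √(‖f b‖ ^ 2 + ε ^ 2) - jacobi m α √(‖f a‖ ^ 2 + ε ^ 2)‖ₑ ≤
      ∫⁻ t in Ioo a b, lagrangian m α f t := by
  obtain ⟨M, hM⟩ := isCompact_uIcc.exists_bound_of_continuousOn hf.continuousOn
  obtain ⟨K, hK⟩ := (contDiff_jacobi_sqrt (m := m) (α := α) hε).contDiffOn.exists_lipschitzOnWith
    one_ne_zero (convex_closedBall 0 M) (isCompact_closedBall 0 M)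
  have hg : AbsolutelyContinuousOnInterval (fun t => jacobi m α √(‖f t‖ ^ 2 + ε ^ 2)) a b :=
    absCont_of_dist_le_mul hf K fun s hs t ht =>
      hK.dist_le_mul _ (mem_closedBall_zero_iff.2 (hM s hs)) _
        (mem_closedBall_zero_iff.2 (hM t ht))
  rw [← hg.integral_deriv_eq_sub, intervalIntegral.integral_of_le hab,
    integral_Ioc_eq_integral_Ioo]
  refine (enorm_integral_le_lintegral_enorm _).trans (lintegral_mono_ae ?_)
  rw [ae_restrict_iff' measurableSet_Ioo]
  filter_upwards [ae_differentiableAt_of_absCont_uIcc hf] with t hft ht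
  exact enorm_deriv_jacobi_sqrt_le hm hα hα2 hε
    (hft (Icc_subset_uIcc (Ioo_subset_Icc_self ht)))

theorem enorm_jacobi_sub_le_lintegral (hm : 0 < m) (hα : 0 < α) (hα2 : α < 2) {f : ℝ → ℂ}
    {a b : ℝ} (hab : a ≤ b) (hf : AbsolutelyContinuousOnInterval f a b) :
    ‖jacobi m α ‖f b‖ - jacobi m α ‖f a‖‖ₑ ≤ ∫⁻ t in Ioo a b, lagrangian m α f t := by
  have hlim : ∀ z : ℂ, Tendsto (fun ε : ℝ => jacobi m α √(‖z‖ ^ 2 + ε ^ 2)) (𝓝[>] 0)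
      (𝓝 (jacobi m α ‖z‖)) := fun z => by
    have hc : Continuous fun ε : ℝ => jacobi m α √(‖z‖ ^ 2 + ε ^ 2) :=
      (continuous_jacobi hα2).comp (by fun_prop)
    simpa using (hc.tendsto 0).mono_left nhdsWithin_le_nhds
  refine le_of_tendsto ((hlim (f b)).sub (hlim (f a))).enorm ?_
  filter_upwards [self_mem_nhdsWithin] with ε hε
  exact enorm_jacobi_sqrt_sub_le_lintegral hm hα hα2 hab hε hf

theorem two_jacobi_le_action (hm : 0 < m) (hα : 0 < α) (hα2 : α < 2) {T r : ℝ} {x : ℝ → ℂ}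
    (hx : MemH1 T x) (hl : ‖x (-T)‖ = r) (hr' : ‖x T‖ = r) {t₀ : ℝ}
    (ht₀ : t₀ ∈ Icc (-T) T) (h0 : x t₀ = 0) :
    ENNReal.ofReal (2 * jacobi m α r) ≤ action m α T x := by
  have hac : ∀ {a b}, a ∈ Icc (-T) T → b ∈ Icc (-T) T → AbsolutelyContinuousOnInterval x a b :=
    fun ha hb => hx.absCont.mono ((uIcc_subset_Icc ha hb).trans Icc_subset_uIcc)
  have hle : -T ≤ T := ht₀.1.trans ht₀.2
  have hJ := jacobi_nonneg (m := m) hα2 (hl ▸ norm_nonneg _)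
  refine le_trans ?_ (lintegral_Ioo_lagrangian_add_le_action ht₀)
  rw [two_mul, ENNReal.ofReal_add hJ hJ]
  refine add_le_add ?_ ?_
  · have h := enorm_jacobi_sub_le_lintegral hm hα hα2 ht₀.1 (hac (left_mem_Icc.2 hle) ht₀)
    rwa [h0, hl, norm_zero, jacobi_zero hα2, zero_sub, enorm_neg,
      Real.enorm_eq_ofReal hJ] at h
  · have h := enorm_jacobi_sub_le_lintegral hm hα hα2 ht₀.2 (hac ht₀ (right_mem_Icc.2 hle))
    rwa [h0, hr', norm_zero, jacobi_zero hα2, sub_zero, Real.enorm_eq_ofReal hJ] at h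

end LowerBound

/-! ### Arcs in polar coordinates -/

/-- The point of the plane with polar coordinates `p = (r, θ)`. Unlike `Complex.polarCoord.symm`
it is used with angles ranging over the whole line. -/
def polar (p : ℝ × ℝ) : ℂ := (p.1 : ℂ) * Complex.exp ((p.2 : ℂ) * Complex.I)

/-- There is a collision-free curve on `[a, b]` of action at most `A` which, in polar coordinates
lifted to `ℝ × ℝ`, goes from `p` to `q`. The curve may have countably many corners. -/
def HasArc (m α a b : ℝ) (p q : ℝ × ℝ) (A : ℝ≥0∞) : Prop :=
  ∃ c : ℝ → ℝ × ℝ, ContinuousOn c (Icc a b) ∧ (∀ t ∈ Icc a b, 0 < (c t).1) ∧ c a = p ∧ c b = q ∧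
    (∃ s : Set ℝ, s.Countable ∧ ∀ t ∈ Ioo a b \ s, DifferentiableAt ℝ (polar ∘ c) t) ∧
    ∫⁻ t in Ioo a b, lagrangian m α (polar ∘ c) t ≤ A

section Arc

variable {m α a b c : ℝ} {p q : ℝ × ℝ}

theorem norm_polar (hp : 0 ≤ p.1) : ‖polar p‖ = p.1 := by
  rw [polar, norm_mul, Complex.norm_exp_ofReal_mul_I, mul_one, Complex.norm_real,
    Real.norm_of_nonneg hp]

theorem continuous_polar : Continuous polar := by
  unfold polar
  fun_prop

theorem hasDerivAt_polar {r θ : ℝ → ℝ} {r' θ' t : ℝ} (hr : HasDerivAt r r' t)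
    (hθ : HasDerivAt θ θ' t) :
    HasDerivAt (fun t => polar (r t, θ t))
      (((r' : ℂ) + ((r t * θ' : ℝ) : ℂ) * Complex.I) * Complex.exp ((θ t : ℂ) * Complex.I)) t := by
  refine (hr.ofReal_comp.mul (((hθ.ofReal_comp).mul_const Complex.I).cexp)).congr_deriv ?_
  push_cast
  ring

theorem lagrangian_polar (hm : 0 < m) (hα : 0 < α) {r θ : ℝ → ℝ} {r' θ' t : ℝ}
    (hr : HasDerivAt r r' t) (hθ : HasDerivAt θ θ' t) (hpos : 0 < r t) :
    lagrangian m α (fun t => polar (r t, θ t)) t =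
      ENNReal.ofReal ((r' ^ 2 + (r t * θ') ^ 2) / 2 + m / α / r t ^ α) := by
  have hn : ‖polar (r t, θ t)‖ = r t := norm_polar hpos.le
  rw [lagrangian, (hasDerivAt_polar hr hθ).deriv,
    potential_eq_ofReal (norm_pos_iff.1 (hn.symm ▸ hpos)), hn,
    norm_mul, Complex.norm_exp_ofReal_mul_I, mul_one, ← Complex.normSq_eq_norm_sq,
    Complex.normSq_add_mul_I, ENNReal.ofReal_add (by positivity) (by positivity)]

theorem lagrangian_congr {x y : ℝ → ℂ} {t : ℝ} (h : x =ᶠ[𝓝 t] y) :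
    lagrangian m α x t = lagrangian m α y t := by
  rw [lagrangian, lagrangian, h.deriv_eq, h.eq_of_nhds]

theorem setLIntegral_lagrangian_congr {x y : ℝ → ℂ} (h : EqOn x y (Ioo a b)) :
    ∫⁻ t in Ioo a b, lagrangian m α x t = ∫⁻ t in Ioo a b, lagrangian m α y t :=
  setLIntegral_congr_fun measurableSet_Ioo fun _ ht =>
    lagrangian_congr (h.eventuallyEq_of_mem (Ioo_mem_nhds ht.1 ht.2))

theorem lagrangian_comp_neg (x : ℝ → ℂ) (t : ℝ) :
    lagrangian m α (fun t => x (-t)) t = lagrangian m α x (-t) := by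
  rw [lagrangian, lagrangian, deriv_comp_neg, norm_neg]

theorem setLIntegral_lagrangian_comp_neg (x : ℝ → ℂ) :
    ∫⁻ t in Ioo (-b) (-a), lagrangian m α (fun t => x (-t)) t =
      ∫⁻ t in Ioo a b, lagrangian m α x t := by
  simp only [lagrangian_comp_neg]
  rw [← neg_Ioo]
  exact (Measure.measurePreserving_neg volume).setLIntegral_comp_preimage_emb
    measurableEmbedding_neg _ _

theorem lintegral_ofReal_deriv {Q Q' : ℝ → ℝ} (hab : a ≤ b) (hQ : ContinuousOn Q (Icc a b))
    (hd : ∀ t ∈ Ioo a b, HasDerivAt Q (Q' t) t) (hQ' : ∀ t ∈ Ioo a b, 0 ≤ Q' t) :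
    ∫⁻ t in Ioo a b, ENNReal.ofReal (Q' t) = ENNReal.ofReal (Q b - Q a) := by
  have hi : IntegrableOn Q' (Ioc a b) := intervalIntegral.integrableOn_deriv_of_nonneg hQ hd hQ'
  rw [← intervalIntegral.integral_eq_sub_of_hasDerivAt_of_le hab hQ hd
    ((intervalIntegrable_iff_integrableOn_Ioc_of_le hab).2 hi),
    intervalIntegral.integral_of_le hab, integral_Ioc_eq_integral_Ioo,
    ofReal_integral_eq_lintegral_ofReal (hi.mono_set Ioo_subset_Ioc_self)]
  exact (ae_restrict_iff' measurableSet_Ioo).2 (ae_of_all _ hQ')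

theorem lintegral_lagrangian_polar (hm : 0 < m) (hα : 0 < α) {r θ r' θ' Q : ℝ → ℝ} (hab : a ≤ b)
    (hpos : ∀ t ∈ Ioo a b, 0 < r t) (hr : ∀ t ∈ Ioo a b, HasDerivAt r (r' t) t)
    (hθ : ∀ t ∈ Ioo a b, HasDerivAt θ (θ' t) t) (hQ : ContinuousOn Q (Icc a b))
    (hQd : ∀ t ∈ Ioo a b, HasDerivAt Q
      ((r' t ^ 2 + (r t * θ' t) ^ 2) / 2 + m / α / r t ^ α) t) :
    ∫⁻ t in Ioo a b, lagrangian m α (fun t => polar (r t, θ t)) t =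
      ENNReal.ofReal (Q b - Q a) := by
  rw [← lintegral_ofReal_deriv hab hQ hQd fun t ht => by have := hpos t ht; positivity]
  exact setLIntegral_congr_fun measurableSet_Ioo fun t ht =>
    lagrangian_polar hm hα (hr t ht) (hθ t ht) (hpos t ht)

theorem hasArc_of_hasDerivAt (hm : 0 < m) (hα : 0 < α) {r θ r' θ' Q : ℝ → ℝ} (hab : a ≤ b)
    (hpos : ∀ t ∈ Icc a b, 0 < r t) (hr : ∀ t ∈ Icc a b, HasDerivAt r (r' t) t)
    (hθ : ∀ t ∈ Icc a b, HasDerivAt θ (θ' t) t)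
    (hQ : ∀ t ∈ Icc a b, HasDerivAt Q ((r' t ^ 2 + (r t * θ' t) ^ 2) / 2 + m / α / r t ^ α) t) :
    HasArc m α a b (r a, θ a) (r b, θ b) (ENNReal.ofReal (Q b - Q a)) := by
  have hsub : ∀ t ∈ Ioo a b, t ∈ Icc a b := fun t ht => Ioo_subset_Icc_self ht
  refine ⟨fun t => (r t, θ t), fun t ht => ?_, hpos, rfl, rfl, ⟨∅, countable_empty, fun t ht => ?_⟩,
    (lintegral_lagrangian_polar hm hα hab (fun t ht => hpos t (hsub t ht))
      (fun t ht => hr t (hsub t ht)) (fun t ht => hθ t (hsub t ht))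
      (fun t ht => (hQ t ht).continuousAt.continuousWithinAt)
      fun t ht => hQ t (hsub t ht)).le⟩
  · exact ((hr t ht).continuousAt.prodMk (hθ t ht).continuousAt).continuousWithinAt
  · exact (hasDerivAt_polar (hr t (hsub t ht.1)) (hθ t (hsub t ht.1))).differentiableAt

theorem HasArc.reverse {A : ℝ≥0∞} (h : HasArc m α a b p q A) :
    HasArc m α (-b) (-a) q p A := by
  obtain ⟨c, hc, hpos, ha, hb, ⟨s, hs, hd⟩, hA⟩ := h
  have hmem : ∀ t ∈ Icc (-b) (-a), -t ∈ Icc a b := fun t ht => ⟨le_neg.1 ht.2, neg_le.1 ht.1⟩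
  refine ⟨fun t => c (-t), hc.comp continuous_neg.continuousOn hmem, fun t ht => hpos _ (hmem t ht),
    by simpa only [neg_neg], by simpa only [neg_neg],
    ⟨-s, hs.preimage neg_injective, fun t ht => ?_⟩,
    (setLIntegral_lagrangian_comp_neg (polar ∘ c)).trans_le hA⟩
  exact (hd (-t) ⟨⟨lt_neg.1 ht.1.2, neg_lt.1 ht.1.1⟩, ht.2⟩).comp t differentiableAt_id.fun_neg

theorem HasArc.trans {A B : ℝ≥0∞} {o : ℝ × ℝ} (hab : a ≤ b) (hbc : b ≤ c)
    (h : HasArc m α a b o p A) (h' : HasArc m α b c p q B) : HasArc m α a c o q (A + B) := by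
  obtain ⟨f, hf, hfpos, hfa, hfb, ⟨s, hs, hfd⟩, hA⟩ := h
  obtain ⟨g, hg, hgpos, hgb, hgc, ⟨s', hs', hgd⟩, hB⟩ := h'
  have hleft : EqOn (fun t => if t ≤ b then f t else g t) f (Icc a b) := fun t ht => if_pos ht.2
  have hright : EqOn (fun t => if t ≤ b then f t else g t) g (Icc b c) := fun t ht => by
    rcases ht.1.eq_or_lt with rfl | hlt
    · exact (if_pos le_rfl).trans (hfb.trans hgb.symm)
    · exact if_neg hlt.not_ge
  generalize (fun t => if t ≤ b then f t else g t) = k at hleft hright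
  have hk : ∀ t ∈ Icc a c, t ∈ Icc a b ∨ t ∈ Icc b c := fun t ht =>
    (le_total t b).imp (fun h => ⟨ht.1, h⟩) fun h => ⟨h, ht.2⟩
  have hleft' : EqOn (polar ∘ k) (polar ∘ f) (Ioo a b) := fun t ht =>
    congrArg polar (hleft (Ioo_subset_Icc_self ht))
  have hright' : EqOn (polar ∘ k) (polar ∘ g) (Ioo b c) := fun t ht =>
    congrArg polar (hright (Ioo_subset_Icc_self ht))
  refine ⟨k, ?_, fun t ht => ?_, (hleft (left_mem_Icc.2 hab)).trans hfa,
    (hright (right_mem_Icc.2 hbc)).trans hgc,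
    ⟨insert b (s ∪ s'), (hs.union hs').insert b, fun t ht => ?_⟩, ?_⟩
  · rw [← Icc_union_Icc_eq_Icc hab hbc]
    exact (hf.congr hleft).union_of_isClosed (hg.congr hright) isClosed_Icc isClosed_Icc
  · rcases hk t ht with h | h
    · exact hleft h ▸ hfpos t h
    · exact hright h ▸ hgpos t h
  · obtain ⟨htI, hts⟩ := ht
    rw [mem_insert_iff, mem_union, not_or, not_or] at hts
    rcases lt_or_gt_of_ne hts.1 with htb | htb
    · exact (hfd t ⟨⟨htI.1, htb⟩, hts.2.1⟩).congr_of_eventuallyEq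
        (hleft'.eventuallyEq_of_mem (Ioo_mem_nhds htI.1 htb))
    · exact (hgd t ⟨⟨htb, htI.2⟩, hts.2.2⟩).congr_of_eventuallyEq
        (hright'.eventuallyEq_of_mem (Ioo_mem_nhds htb htI.2))
  · rw [setLIntegral_congr Ioo_ae_eq_Ioc, ← Ioc_union_Ioc_eq_Ioc hab hbc]
    refine (lintegral_union_le _ _ _).trans (add_le_add ?_ ?_)
    · rwa [← setLIntegral_congr Ioo_ae_eq_Ioc, setLIntegral_lagrangian_congr hleft']
    · rwa [← setLIntegral_congr Ioo_ae_eq_Ioc, setLIntegral_lagrangian_congr hright']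

end Arc

/-! ### Radial arcs and the collision-ejection solution -/

/-- The radius of the parabolic collision-ejection solution at time `t ≥ 0`. -/
def rbar (m α t : ℝ) : ℝ := (mu m α * t) ^ (2 / (α + 2))

section RadialArc

variable {m α : ℝ}

theorem mu_eq (hα : 0 < α) : mu m α = (α + 2) / 2 * √(2 * m / α) := by
  rw [mu, ← Real.sqrt_eq_rpow, show 2 * m / α = 2 ^ 2 * (m / (2 * α)) by field_simp,
    Real.sqrt_mul (by positivity), Real.sqrt_sq (by norm_num)]
  ring

theorem mu_pos (hm : 0 < m) (hα : 0 < α) : 0 < mu m α := by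
  unfold mu
  positivity

theorem rbar_pos (hm : 0 < m) (hα : 0 < α) {t : ℝ} (ht : 0 < t) : 0 < rbar m α t :=
  Real.rpow_pos_of_pos (mul_pos (mu_pos hm hα) ht) _

theorem rbar_zero (hα : 0 < α) : rbar m α 0 = 0 := by
  rw [rbar, mul_zero, Real.zero_rpow (by positivity)]

theorem continuous_rbar (hα : 0 < α) : Continuous (rbar m α) :=
  (Real.continuous_rpow_const (by positivity)).comp (continuous_const.mul continuous_id)

theorem rbar_rpow (hm : 0 < m) (hα : 0 < α) {t : ℝ} (ht : 0 < t) (q : ℝ) :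
    rbar m α t ^ q = (mu m α * t) ^ (2 / (α + 2) * q) := by
  rw [rbar, ← Real.rpow_mul (mul_pos (mu_pos hm hα) ht).le]

theorem hasDerivAt_rbar (hm : 0 < m) (hα : 0 < α) {t : ℝ} (ht : 0 < t) :
    HasDerivAt (rbar m α) (√(2 * m / α) * rbar m α t ^ (-(α / 2))) t := by
  have hμt := mul_pos (mu_pos hm hα) ht
  refine ((hasDerivAt_const_mul (mu m α)).rpow_const (p := 2 / (α + 2))
    (Or.inl hμt.ne')).congr_deriv ?_
  rw [rbar_rpow hm hα ht, show 2 / (α + 2) - 1 = 2 / (α + 2) * -(α / 2) by field_simp; ring,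
    mu_eq hα]
  field_simp

theorem jacobi_rbar (hm : 0 < m) (hα : 0 < α) {t : ℝ} (ht : 0 < t) :
    jacobi m α (rbar m α t) =
      √(2 * m / α) / (1 - α / 2) * (mu m α * t) ^ ((2 - α) / (α + 2)) := by
  rw [jacobi, rbar_rpow hm hα ht]
  congr 2
  field_simp

theorem jacobi_rbar_le_jacobi_rbar (hm : 0 < m) (hα : 0 < α) (hα2 : α < 2) {s T : ℝ} (hs : 0 < s)
    (hsT : s ≤ T) : jacobi m α (rbar m α s) ≤ jacobi m α (rbar m α T) := by
  refine jacobi_le_jacobi hα2 (rbar_pos hm hα hs).le ?_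
  have := mu_pos hm hα
  unfold rbar
  gcongr

theorem div_mul_jacobi_rbar_le (hm : 0 < m) (hα : 0 < α) (hα2 : α < 2) {s T : ℝ} (hs : 0 < s)
    (hsT : s ≤ T) : s / T * jacobi m α (rbar m α T) ≤ jacobi m α (rbar m α s) := by
  have hT := hs.trans_le hsT
  have hμ := mu_pos hm hα
  have hβ : 0 < 1 - α / 2 := by linarith
  have hconc : s / T ≤ (s / T) ^ ((2 - α) / (α + 2)) := by
    refine Real.self_le_rpow_of_le_one (by positivity) ((div_le_one hT).2 hsT) ?_
    rw [div_le_one (by positivity)]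
    linarith
  rw [jacobi_rbar hm hα hs, jacobi_rbar hm hα hT,
    show mu m α * s = s / T * (mu m α * T) by field_simp,
    Real.mul_rpow (x := s / T) (by positivity) (by positivity), mul_left_comm]
  gcongr

theorem hasDerivAt_jacobi_rbar (hm : 0 < m) (hα : 0 < α) (hα2 : α < 2) {t : ℝ} (ht : 0 < t) :
    HasDerivAt (fun t => jacobi m α (rbar m α t)) (2 * (m / α / rbar m α t ^ α)) t := by
  have hr := rbar_pos hm hα ht
  refine ((hasDerivAt_jacobi hα2 hr).comp t (hasDerivAt_rbar hm hα ht)).congr_deriv ?_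
  rw [← sq_sqrt_mul_rpow hm hα hr]
  ring

-- Running the parabolic solution linearly in time with stretching factor `l` replaces its action
-- `J` by `(l + 1 / l) / 2 * J`.
theorem hasArc_radial (hm : 0 < m) (hα : 0 < α) (hα2 : α < 2) {a b s S : ℝ} (hab : a < b)
    (hs : 0 < s) (hsS : s < S) (φ : ℝ) :
    HasArc m α a b (rbar m α s, φ) (rbar m α S, φ)
      (ENNReal.ofReal (((b - a) / (S - s) + (S - s) / (b - a)) / 2 *
        (jacobi m α (rbar m α S) - jacobi m α (rbar m α s)))) := by
  obtain ⟨k, hk⟩ : ∃ k, k = (S - s) / (b - a) := ⟨_, rfl⟩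
  have hk0 : 0 < k := hk ▸ div_pos (sub_pos.2 hsS) (sub_pos.2 hab)
  have hw : ∀ t ∈ Icc a b, 0 < s + k * (t - a) := fun t ht => by
    have := mul_nonneg hk0.le (sub_nonneg.2 ht.1)
    linarith
  have hwd : ∀ t, HasDerivAt (fun t => s + k * (t - a)) k t := fun t => by
    simpa using (((hasDerivAt_id t).sub_const a).const_mul k).const_add s
  have hwb : s + k * (b - a) = S := by
    rw [hk, div_mul_cancel₀ _ (sub_pos.2 hab).ne']
    ring
  have hrd : ∀ t ∈ Icc a b, HasDerivAt (fun t => rbar m α (s + k * (t - a)))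
      (√(2 * m / α) * rbar m α (s + k * (t - a)) ^ (-(α / 2)) * k) t := fun t ht =>
    (hasDerivAt_rbar hm hα (hw t ht)).comp (h := fun t => s + k * (t - a)) t (hwd t)
  have harc := hasArc_of_hasDerivAt hm hα hab.le (fun t ht => rbar_pos hm hα (hw t ht)) hrd
    (fun t _ => hasDerivAt_const t φ)
    (Q := fun t => (k⁻¹ + k) / 2 * jacobi m α (rbar m α (s + k * (t - a)))) fun t ht => by
      refine (((hasDerivAt_jacobi_rbar hm hα hα2 (hw t ht)).comp t (hwd t)).const_mul
        ((k⁻¹ + k) / 2)).congr_deriv ?_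
      rw [mul_pow, sq_sqrt_mul_rpow hm hα (rbar_pos hm hα (hw t ht))]
      field_simp
      ring
  simp only [hwb, sub_self, mul_zero, add_zero, ← mul_sub] at harc
  rwa [hk, inv_div] at harc

variable {T φm φp : ℝ}

theorem xbar_eq_polar (m α φm φp t : ℝ) :
    xbar m α φm φp t = polar (rbar m α |t|, if 0 ≤ t then φp else φm) := rfl

theorem norm_xbar (hm : 0 < m) (hα : 0 < α) (t : ℝ) : ‖xbar m α φm φp t‖ = rbar m α |t| := by
  have := mu_pos hm hα
  exact norm_polar (p := (rbar m α |t|, _)) (by unfold rbar; positivity)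

theorem xbar_of_nonneg {t : ℝ} (ht : 0 ≤ t) : xbar m α φm φp t = polar (rbar m α t, φp) := by
  rw [xbar_eq_polar, abs_of_nonneg ht, if_pos ht]

theorem xbar_of_neg {t : ℝ} (ht : t < 0) : xbar m α φm φp t = polar (rbar m α (-t), φm) := by
  rw [xbar_eq_polar, abs_of_neg ht, if_neg ht.not_ge]

theorem setLIntegral_lagrangian_rbar (hm : 0 < m) (hα : 0 < α) (hα2 : α < 2) (hT : 0 < T)
    (φ : ℝ) : ∫⁻ t in Ioo 0 T, lagrangian m α (fun t => polar (rbar m α t, φ)) t =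
      ENNReal.ofReal (jacobi m α (rbar m α T)) := by
  refine (lintegral_lagrangian_polar hm hα (Q := fun t => jacobi m α (rbar m α t)) hT.le
    (fun t ht => rbar_pos hm hα ht.1) (fun t ht => hasDerivAt_rbar hm hα ht.1)
    (fun t _ => hasDerivAt_const t φ)
    ((continuous_jacobi hα2).comp (continuous_rbar hα)).continuousOn fun t ht => ?_).trans ?_
  · refine (hasDerivAt_jacobi_rbar hm hα hα2 ht.1).congr_deriv ?_
    rw [sq_sqrt_mul_rpow hm hα (rbar_pos hm hα ht.1)]
    ring
  · rw [rbar_zero hα, jacobi_zero hα2, sub_zero]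

theorem two_jacobi_le_action_xbar (hm : 0 < m) (hα : 0 < α) (hα2 : α < 2) (hT : 0 < T) :
    ENNReal.ofReal (2 * jacobi m α (rbar m α T)) ≤ action m α T (xbar m α φm φp) := by
  have hJ := jacobi_nonneg (m := m) hα2 (rbar_pos hm hα hT).le
  refine le_trans (le_of_eq ?_) (lintegral_Ioo_lagrangian_add_le_action
    (t₀ := 0) ⟨neg_nonpos.2 hT.le, hT.le⟩)
  rw [two_mul, ENNReal.ofReal_add hJ hJ,
    setLIntegral_lagrangian_congr fun t ht => xbar_of_nonneg ht.1.le,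
    setLIntegral_lagrangian_congr fun t ht => xbar_of_neg ht.2, ← neg_zero,
    setLIntegral_lagrangian_comp_neg fun t => polar (rbar m α t, φm), neg_zero,
    setLIntegral_lagrangian_rbar hm hα hα2 hT, setLIntegral_lagrangian_rbar hm hα hα2 hT]

theorem HasArc.exists_mem_GammaStar {A : ℝ≥0∞} (hT : 0 < T)
    (h : HasArc m α (-T) T (rbar m α T, φm) (rbar m α T, φp) A) (hA : A ≠ ⊤) :
    ∃ x ∈ GammaStar m α T φm φp, action m α T x ≤ A := by
  obtain ⟨c, hc, hpos, hl, hr, ⟨s, hs, hd⟩, hcA⟩ := h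
  have hact : action m α T (polar ∘ c) ≤ A := by
    rwa [action, setLIntegral_congr Ioo_ae_eq_Icc.symm]
  have hmem : MemH1 T (polar ∘ c) := by
    refine memH1_of_energy hT hs (continuous_polar.comp_continuousOn hc) hd ?_
    exact ne_top_of_le_ne_top hA ((lintegral_mono fun t => le_self_add).trans hact)
  have hnorm : ∀ t ∈ Icc (-T) T, ‖polar (c t)‖ = (c t).1 := fun t ht => norm_polar (hpos t ht).le
  refine ⟨⟨polar ∘ c, hmem⟩, ⟨fun t ht => norm_pos_iff.1 ((hnorm t ht).symm ▸ hpos t ht), ?_, ?_,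
    fun t => (c t).2, hc.snd, congrArg Prod.snd hl, congrArg Prod.snd hr,
    fun t ht => ?_⟩, hact⟩
  · rw [xbar_of_neg (neg_neg_iff_pos.2 hT), neg_neg]
    exact congrArg polar hl
  · rw [xbar_of_nonneg hT.le]
    exact congrArg polar hr
  · change polar (c t) = (‖polar (c t)‖ : ℂ) * _
    rw [hnorm t ht, polar]

theorem HasArc.exists_mem_GammaStar_of_radial (hm : 0 < m) (hα : 0 < α) (hα2 : α < 2) {s τ A : ℝ}
    (hτ : 0 ≤ τ) (hτT : τ < T) (hs : 0 < s) (hsT : s < T) (hA : 0 ≤ A)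
    (h : HasArc m α (-τ) τ (rbar m α s, φm) (rbar m α s, φp) (ENNReal.ofReal A)) :
    ∃ x ∈ GammaStar m α T φm φp, action m α T x ≤
      ENNReal.ofReal (A + ((T - τ) / (T - s) + (T - s) / (T - τ)) *
        (jacobi m α (rbar m α T) - jacobi m α (rbar m α s))) := by
  obtain ⟨B, hB⟩ : ∃ B, B = ((T - τ) / (T - s) + (T - s) / (T - τ)) / 2 *
      (jacobi m α (rbar m α T) - jacobi m α (rbar m α s)) := ⟨_, rfl⟩
  have hB0 : 0 ≤ B := by
    have := sub_pos.2 hτT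
    have := sub_pos.2 hsT
    exact hB ▸ mul_nonneg (by positivity)
      (sub_nonneg.2 (jacobi_rbar_le_jacobi_rbar hm hα hα2 hs hsT.le))
  have hleg : ∀ φ, HasArc m α τ T (rbar m α s, φ) (rbar m α T, φ) (ENNReal.ofReal B) :=
    hB ▸ hasArc_radial hm hα hα2 hτT hs hsT
  obtain ⟨x, hx, hxA⟩ := (((hleg φm).reverse.trans (neg_le_neg hτT.le) (by linarith) h).trans
    (by linarith) hτT.le (hleg φp)).exists_mem_GammaStar (hτ.trans_lt hτT) (by finiteness)
  refine ⟨x, hx, hxA.trans_eq ?_⟩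
  rw [← ENNReal.ofReal_add hB0 hA, ← ENNReal.ofReal_add (by positivity) hB0, hB]
  ring_nf

end RadialArc

/-! ### Comparison curves -/

section Comparison

variable {m α : ℝ}

theorem hasArc_circle (hm : 0 < m) (hα : 0 < α) {r s : ℝ} (hr : 0 < r) (hs : 0 < s)
    (φ₀ φ₁ : ℝ) : HasArc m α (-s) s (r, φ₀) (r, φ₁)
      (ENNReal.ofReal ((r * (φ₁ - φ₀)) ^ 2 / (4 * s) + 2 * s * (m / α / r ^ α))) := by
  have harc := hasArc_of_hasDerivAt hm hα (r := fun _ => r)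
    (θ := fun t => (φ₀ + φ₁) / 2 + (φ₁ - φ₀) / (2 * s) * t) (neg_le_self hs.le)
    (fun _ _ => hr) (fun t _ => hasDerivAt_const t r)
    (fun t _ => (hasDerivAt_const_mul _).const_add _) fun t _ => hasDerivAt_const_mul _
  convert harc using 2
  · field_simp
    ring
  · field_simp
    ring
  · rw [zero_pow two_ne_zero, zero_add]
    field_simp
    ring

theorem tendsto_action_circle (hm : 0 < m) (hα : 0 < α) (hα2 : α < 2) (φ : ℝ) :
    Tendsto (fun s => (rbar m α s * φ) ^ 2 / (4 * s) + 2 * s * (m / α / rbar m α s ^ α))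
      (𝓝[>] 0) (𝓝 0) := by
  have hμ := mu_pos hm hα
  obtain ⟨q, hq⟩ : ∃ q, q = (2 - α) / (α + 2) := ⟨_, rfl⟩
  have hq0 : 0 < q := hq ▸ div_pos (by linarith) (by linarith)
  have hlim : Tendsto (fun s => (mu m α * φ ^ 2 / 4 + 2 * m / (α * mu m α)) * (mu m α * s) ^ q)
      (𝓝 0) (𝓝 0) := by
    refine Continuous.tendsto' ?_ 0 0 (by rw [mul_zero, Real.zero_rpow hq0.ne', mul_zero])
    exact continuous_const.mul ((Real.continuous_rpow_const hq0.le).comp (by fun_prop))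
  refine (hlim.mono_left nhdsWithin_le_nhds).congr' ?_
  filter_upwards [self_mem_nhdsWithin] with s hs
  have hs0 : 0 < s := hs
  have hμs := mul_pos hμ hs0
  have hsq : rbar m α s ^ 2 = (mu m α * s) ^ q * (mu m α * s) := by
    rw [← Real.rpow_natCast, rbar_rpow hm hα hs0, ← Real.rpow_add_one hμs.ne', hq]
    congr 1
    push_cast
    field_simp
    ring
  have hrpow : (mu m α * s) ^ q * rbar m α s ^ α = mu m α * s := by
    rw [rbar_rpow hm hα hs0, ← Real.rpow_add hμs, hq,
      show (2 - α) / (α + 2) + 2 / (α + 2) * α = 1 by field_simp; ring, Real.rpow_one]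
  have hdiv : s / rbar m α s ^ α = (mu m α * s) ^ q / mu m α := by
    rw [div_eq_div_iff (Real.rpow_pos_of_pos (rbar_pos hm hα hs0) _).ne' hμ.ne', hrpow, mul_comm]
  rw [mul_pow, hsq, show 2 * s * (m / α / rbar m α s ^ α) =
    2 * (m / α) * (s / rbar m α s ^ α) by ring, hdiv]
  field_simp

theorem exists_mem_GammaStar_action_le {T φm φp ε : ℝ} (hm : 0 < m) (hα : 0 < α) (hα2 : α < 2)
    (hT : 0 < T) (hε : 0 < ε) : ∃ x ∈ GammaStar m α T φm φp,
      action m α T x ≤ ENNReal.ofReal (2 * jacobi m α (rbar m α T) + ε) := by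
  obtain ⟨s, hsε, hs, hsT⟩ := (((tendsto_action_circle hm hα hα2 (φp - φm)).eventually_lt_const
    hε).and (Ioo_mem_nhdsGT hT)).exists
  have hr := rbar_pos hm hα hs
  obtain ⟨x, hx, hxA⟩ := (hasArc_circle hm hα hr hs φm φp).exists_mem_GammaStar_of_radial hm hα
    hα2 hs.le hsT hs hsT (by positivity)
  refine ⟨x, hx, hxA.trans (ENNReal.ofReal_le_ofReal ?_)⟩
  rw [div_self (sub_pos.2 hsT).ne']
  linarith [jacobi_nonneg (m := m) hα2 hr.le]

theorem exists_reparametrization {G : ℝ → ℝ} {g : ℝ} (hG : Continuous G) (hg : 0 < g)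
    (hgG : ∀ x, g ≤ G x) (t₀ x₀ : ℝ) :
    ∃ u : ℝ → ℝ, (∀ t, HasDerivAt u (G (u t))⁻¹ t) ∧ ∀ x, u (t₀ + ∫ v in x₀..x, G v) = x := by
  obtain ⟨P, hP⟩ : ∃ P : ℝ → ℝ, P = fun x => t₀ + ∫ v in x₀..x, G v := ⟨_, rfl⟩
  have hPd : ∀ x, HasDerivAt P (G x) x := fun x => hP ▸
    (intervalIntegral.integral_hasDerivAt_right (hG.intervalIntegrable _ _)
      (hG.stronglyMeasurableAtFilter _ _) hG.continuousAt).const_add t₀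
  have hPc : Continuous P := continuous_iff_continuousAt.2 fun x => (hPd x).continuousAt
  have hmono : StrictMono P := strictMono_of_deriv_pos fun x => by
    rw [(hPd x).deriv]
    exact hg.trans_le (hgG x)
  have hgrow : Monotone fun x => P x - g * x := by
    refine monotone_of_deriv_nonneg (fun x => ((hPd x).sub
      (hasDerivAt_const_mul g)).differentiableAt) fun x => ?_
    rw [((hPd x).fun_sub (hasDerivAt_const_mul g)).deriv]
    exact sub_nonneg.2 (hgG x)
  have htop : Tendsto P atTop atTop := by
    refine tendsto_atTop_mono' _ ?_
      (tendsto_atTop_add_const_left atTop (P 0) (tendsto_id.const_mul_atTop hg))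
    filter_upwards [eventually_ge_atTop 0] with x hx
    have := hgrow hx
    simp only [mul_zero, sub_zero, id] at this ⊢
    linarith
  have hbot : Tendsto P atBot atBot := by
    refine tendsto_atBot_mono' _ ?_
      (tendsto_atBot_add_const_left atBot (P 0) (tendsto_id.const_mul_atBot hg))
    filter_upwards [eventually_le_atBot 0] with x hx
    have := hgrow hx
    simp only [mul_zero, sub_zero, id] at this ⊢
    linarith
  let e := hmono.orderIsoOfSurjective P (hPc.surjective htop hbot)
  refine ⟨e.symm, fun t => ?_, fun x => ?_⟩
  · exact (hPd (e.symm t)).of_local_left_inverse e.symm.continuous.continuousAt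
      (hg.trans_le (hgG _)).ne' (Eventually.of_forall e.apply_symm_apply)
  · exact (congrArg e.symm (congrFun hP x).symm).trans (e.symm_apply_apply x)

-- Maupertuis' principle: run through at zero energy, a path has action equal to its Jacobi length,
-- and `G` is the resulting time density.
theorem hasArc_of_zero_energy (hm : 0 < m) (hα : 0 < α) {r θ r' θ' G Q : ℝ → ℝ} {g : ℝ}
    (hpos : ∀ x, 0 < r x) (hr : ∀ x, HasDerivAt r (r' x) x) (hθ : ∀ x, HasDerivAt θ (θ' x) x)
    (hG : Continuous G) (hg : 0 < g) (hgG : ∀ x, g ≤ G x)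
    (henergy : ∀ x, (r' x ^ 2 + (r x * θ' x) ^ 2) / 2 = m / α / r x ^ α * G x ^ 2)
    (hQ : ∀ x, HasDerivAt Q (2 * (m / α / r x ^ α) * G x) x) (t₀ : ℝ) {x₀ x₁ : ℝ} (hx : x₀ ≤ x₁) :
    HasArc m α t₀ (t₀ + ∫ v in x₀..x₁, G v) (r x₀, θ x₀) (r x₁, θ x₁)
      (ENNReal.ofReal (Q x₁ - Q x₀)) := by
  obtain ⟨u, hu, hinv⟩ := exists_reparametrization hG hg hgG t₀ x₀
  have hG0 : ∀ x, 0 < G x := fun x => hg.trans_le (hgG x)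
  have h₀ : u t₀ = x₀ := by simpa using hinv x₀
  have harc := hasArc_of_hasDerivAt hm hα (Q := fun t => Q (u t)) (a := t₀)
    (b := t₀ + ∫ v in x₀..x₁, G v)
    (le_add_of_nonneg_right (intervalIntegral.integral_nonneg hx fun v _ => (hG0 v).le))
    (fun t _ => hpos (u t)) (fun t _ => (hr (u t)).comp t (hu t))
    (fun t _ => (hθ (u t)).comp t (hu t)) fun t _ => by
      refine ((hQ (u t)).comp t (hu t)).congr_deriv ?_
      have := hG0 (u t)
      rw [show (r' (u t) * (G (u t))⁻¹) ^ 2 + (r (u t) * (θ' (u t) * (G (u t))⁻¹)) ^ 2 =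
        2 * ((r' (u t) ^ 2 + (r (u t) * θ' (u t)) ^ 2) / 2) / G (u t) ^ 2 by field_simp,
        henergy]
      field_simp
      ring
  simpa only [Function.comp_apply, h₀, hinv] using harc

/-- The straight line `a + iu` of the plane of the variable `x ^ (1 - α / 2)`, in polar coordinates
of the `x`-plane and rotated by the angle `φ`. The map `x ↦ x ^ (1 - α / 2)` turns the Jacobi metric
at zero energy into a flat one, so these are the zero-energy orbits. -/
def chord (α a φ u : ℝ) : ℝ × ℝ :=
  ((a ^ 2 + u ^ 2) ^ (1 / (2 - α)), φ + Real.arctan (u / a) / (1 - α / 2))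

theorem chord_mul_cos_mul_sin (hα2 : α < 2) {r ω : ℝ} (hr : 0 < r)
    (hω : ω ∈ Ioo (-(Real.pi / 2)) (Real.pi / 2)) (φ : ℝ) :
    chord α (r ^ (1 - α / 2) * Real.cos ω) φ (r ^ (1 - α / 2) * Real.sin ω) =
      (r, φ + ω / (1 - α / 2)) := by
  have hρ := Real.rpow_pos_of_pos hr (1 - α / 2)
  rw [chord, mul_div_mul_left _ _ hρ.ne', ← Real.tan_eq_sin_div_cos, Real.arctan_tan hω.1 hω.2,
    mul_pow, mul_pow, ← mul_add, Real.cos_sq_add_sin_sq, mul_one, ← Real.rpow_natCast,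
    ← Real.rpow_mul hr.le, ← Real.rpow_mul hr.le]
  congr 1
  have : 2 - α ≠ 0 := by linarith
  rw [show (1 - α / 2) * (2 : ℕ) * (1 / (2 - α)) = 1 by push_cast; field_simp, Real.rpow_one]

theorem chord_fst_pos {a : ℝ} (ha : 0 < a) (φ u : ℝ) : 0 < (chord α a φ u).1 :=
  Real.rpow_pos_of_pos (by positivity) _

theorem chord_fst_rpow (a φ u : ℝ) : (chord α a φ u).1 ^ α = (a ^ 2 + u ^ 2) ^ (α / (2 - α)) := by
  rw [chord, ← Real.rpow_mul (by positivity), one_div_mul_eq_div]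

theorem chord_fst_sq (hα2 : α < 2) {a : ℝ} (ha : 0 < a) (φ u : ℝ) :
    (chord α a φ u).1 ^ 2 = (a ^ 2 + u ^ 2) ^ (α / (2 - α)) * (a ^ 2 + u ^ 2) := by
  have hD : 0 < a ^ 2 + u ^ 2 := by positivity
  have : 2 - α ≠ 0 := by linarith
  rw [chord, ← Real.rpow_natCast, ← Real.rpow_mul hD.le, ← Real.rpow_add_one hD.ne']
  congr 1
  push_cast
  field_simp
  ring

theorem hasDerivAt_chord_fst (hα2 : α < 2) {a : ℝ} (ha : 0 < a) (φ u : ℝ) :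
    HasDerivAt (fun u => (chord α a φ u).1)
      ((chord α a φ u).1 * u / ((1 - α / 2) * (a ^ 2 + u ^ 2))) u := by
  have hD : 0 < a ^ 2 + u ^ 2 := by positivity
  have h2 : 2 - α ≠ 0 := by linarith
  refine (((hasDerivAt_pow 2 u).const_add (a ^ 2)).rpow_const
    (p := 1 / (2 - α)) (Or.inl hD.ne')).congr_deriv ?_
  rw [Real.rpow_sub_one hD.ne', chord, show 1 - α / 2 = (2 - α) / 2 by ring]
  field_simp
  push_cast
  ring

theorem hasDerivAt_chord_snd (hα2 : α < 2) {a : ℝ} (ha : 0 < a) (φ u : ℝ) :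
    HasDerivAt (fun u => (chord α a φ u).2) (a / ((1 - α / 2) * (a ^ 2 + u ^ 2))) u := by
  have : 1 - α / 2 ≠ 0 := by linarith
  refine ((((hasDerivAt_id u).div_const a).arctan.div_const
    (1 - α / 2)).const_add φ).congr_deriv ?_
  simp only [id]
  field_simp

theorem continuous_add_sq_rpow_div {q : ℝ} (hq : 0 ≤ q) (a k : ℝ) :
    Continuous fun u : ℝ => (a ^ 2 + u ^ 2) ^ q / k :=
  Continuous.div_const ((Real.continuous_rpow_const hq).comp (by fun_prop)) k

theorem hasArc_chord (hm : 0 < m) (hα : 0 < α) (hα2 : α < 2) {a : ℝ} (ha : 0 < a) (φ t₀ : ℝ)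
    {u₀ u₁ : ℝ} (hu : u₀ ≤ u₁) :
    HasArc m α t₀
      (t₀ + ∫ u in u₀..u₁, (a ^ 2 + u ^ 2) ^ (α / (2 - α)) / (√(2 * m / α) * (1 - α / 2)))
      (chord α a φ u₀) (chord α a φ u₁)
      (ENNReal.ofReal (√(2 * m / α) / (1 - α / 2) * u₁ - √(2 * m / α) / (1 - α / 2) * u₀)) := by
  have hα2' : 0 < 2 - α := by linarith
  have hβ : 0 < 1 - α / 2 := by linarith
  have hexp : 0 ≤ α / (2 - α) := by positivity
  have : 0 < √(2 * m / α) := Real.sqrt_pos.2 (by positivity)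
  have hk2 : m / α = √(2 * m / α) ^ 2 / 2 := by
    rw [Real.sq_sqrt (by positivity)]
    ring
  have hD : ∀ u, 0 < a ^ 2 + u ^ 2 := fun u => by positivity
  refine hasArc_of_zero_energy hm hα (g := (a ^ 2) ^ (α / (2 - α)) / (√(2 * m / α) * (1 - α / 2)))
    (Q := fun u => √(2 * m / α) / (1 - α / 2) * u) (chord_fst_pos ha φ)
    (hasDerivAt_chord_fst hα2 ha φ) (hasDerivAt_chord_snd hα2 ha φ)
    (continuous_add_sq_rpow_div hexp a _) (by positivity)
    (fun u => ?_) (fun u => ?_) (fun u => (hasDerivAt_const_mul _).congr_deriv ?_) t₀ hu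
  · gcongr
    exact le_add_of_nonneg_right (sq_nonneg u)
  · have := Real.rpow_pos_of_pos (hD u) (α / (2 - α))
    have := hD u
    rw [mul_div_assoc, mul_pow, mul_pow, ← mul_add, div_pow, div_pow, ← add_div,
      chord_fst_sq hα2 ha, chord_fst_rpow, hk2]
    field_simp
    ring
  · have := Real.rpow_pos_of_pos (hD u) (α / (2 - α))
    rw [chord_fst_rpow, hk2]
    field_simp

theorem integral_rpow_div_le {a b q k : ℝ} (hb : 0 ≤ b) (hq : 0 ≤ q) (hk : 0 < k) :
    ∫ u in -b..b, (a ^ 2 + u ^ 2) ^ q / k ≤ 2 * b * ((a ^ 2 + b ^ 2) ^ q / k) := by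
  refine (intervalIntegral.integral_mono_on (g := fun _ => (a ^ 2 + b ^ 2) ^ q / k)
    (neg_le_self hb) ((continuous_add_sq_rpow_div hq a k).intervalIntegrable _ _)
    intervalIntegrable_const fun u hu => ?_).trans_eq ?_
  · have := sq_le_sq' hu.1 hu.2
    gcongr
  · rw [intervalIntegral.integral_const, smul_eq_mul, sub_neg_eq_add, ← two_mul]

theorem rpow_mul_sq_rpow (hα2 : α < 2) {r : ℝ} (hr : 0 < r) :
    r ^ (1 - α / 2) * ((r ^ (1 - α / 2)) ^ 2) ^ (α / (2 - α)) = r ^ (1 + α / 2) := by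
  have : 2 - α ≠ 0 := by linarith
  rw [← Real.rpow_natCast, ← Real.rpow_mul hr.le, ← Real.rpow_mul hr.le, ← Real.rpow_add hr]
  congr 1
  push_cast
  field_simp
  ring

theorem integral_rpow_div_sector_le (hα : 0 ≤ α) (hα2 : α < 2) {r ω k : ℝ} (hr : 0 < r) (hk : 0 < k)
    (hω : 0 ≤ Real.sin ω) :
    ∫ u in -(r ^ (1 - α / 2) * Real.sin ω)..r ^ (1 - α / 2) * Real.sin ω,
      ((r ^ (1 - α / 2) * Real.cos ω) ^ 2 + u ^ 2) ^ (α / (2 - α)) / k ≤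
      2 * (r ^ (1 + α / 2) / k) := by
  have hρ : 0 < r ^ (1 - α / 2) := Real.rpow_pos_of_pos hr _
  have hexp : 0 ≤ α / (2 - α) := div_nonneg hα (by linarith)
  refine (integral_rpow_div_le (mul_nonneg hρ.le hω) hexp hk).trans ?_
  rw [mul_pow, mul_pow, ← mul_add, Real.cos_sq_add_sin_sq, mul_one, mul_assoc]
  refine mul_le_mul_of_nonneg_left ?_ two_pos.le
  calc r ^ (1 - α / 2) * Real.sin ω * (((r ^ (1 - α / 2)) ^ 2) ^ (α / (2 - α)) / k)
      ≤ r ^ (1 - α / 2) * (((r ^ (1 - α / 2)) ^ 2) ^ (α / (2 - α)) / k) := by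
        gcongr
        exact mul_le_of_le_one_right hρ.le (Real.sin_le_one ω)
    _ = r ^ (1 + α / 2) / k := by rw [← mul_div_assoc, rpow_mul_sq_rpow hα2 hr]

theorem exists_hasArc_sector (hm : 0 < m) (hα : 0 < α) (hα2 : α < 2) {r ω : ℝ} (hr : 0 < r)
    (hω : 0 ≤ ω) (hω' : ω < Real.pi / 2) (φ : ℝ) :
    ∃ τ, 0 ≤ τ ∧ τ ≤ r ^ (1 + α / 2) / (√(2 * m / α) * (1 - α / 2)) ∧
      HasArc m α (-τ) τ (r, φ - ω / (1 - α / 2)) (r, φ + ω / (1 - α / 2))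
        (ENNReal.ofReal (2 * jacobi m α r * Real.sin ω)) := by
  have hβ : 0 < 1 - α / 2 := by linarith
  have hk : 0 < √(2 * m / α) := Real.sqrt_pos.2 (by positivity)
  have hωI : ω ∈ Ioo (-(Real.pi / 2)) (Real.pi / 2) := ⟨by linarith, hω'⟩
  have hsin : 0 ≤ Real.sin ω := Real.sin_nonneg_of_nonneg_of_le_pi hω (by linarith)
  have hstart := chord_mul_cos_mul_sin hα2 hr (ω := -ω) ⟨neg_lt_neg hω', by linarith⟩ φ
  have hend := chord_mul_cos_mul_sin hα2 hr hωI φ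
  have htime := integral_rpow_div_sector_le hα.le hα2 hr (mul_pos hk hβ) hsin
  obtain ⟨ρ, hρ⟩ : ∃ ρ, ρ = r ^ (1 - α / 2) := ⟨_, rfl⟩
  rw [← hρ] at htime hend
  rw [Real.cos_neg, Real.sin_neg, mul_neg, neg_div, ← sub_eq_add_neg, ← hρ] at hstart
  have hρ0 : 0 < ρ := hρ ▸ Real.rpow_pos_of_pos hr _
  have hb : -(ρ * Real.sin ω) ≤ ρ * Real.sin ω := neg_le_self (mul_nonneg hρ0.le hsin)
  obtain ⟨τ, hτ⟩ : ∃ τ, τ = (∫ u in -(ρ * Real.sin ω)..ρ * Real.sin ω,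
    ((ρ * Real.cos ω) ^ 2 + u ^ 2) ^ (α / (2 - α)) / (√(2 * m / α) * (1 - α / 2))) / 2 := ⟨_, rfl⟩
  have hτ0 : 0 ≤ τ := hτ ▸
    div_nonneg (intervalIntegral.integral_nonneg hb fun u _ => by positivity) two_pos.le
  refine ⟨τ, hτ0, by linarith, ?_⟩
  have harc := hasArc_chord hm hα hα2 (mul_pos hρ0 (Real.cos_pos_of_mem_Ioo hωI)) φ (-τ) hb
  rw [hstart, hend] at harc
  convert harc using 2
  · linarith
  · rw [jacobi, ← hρ]
    ring

theorem exists_hasArc_of_angle_lt_pi (hm : 0 < m) (hα : 0 < α) (hα2 : α < 2) {r φ₀ φ₁ : ℝ}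
    (hr : 0 < r) (hφ : (1 - α / 2) * |φ₁ - φ₀| < Real.pi) :
    ∃ τ, 0 ≤ τ ∧ τ ≤ r ^ (1 + α / 2) / (√(2 * m / α) * (1 - α / 2)) ∧
      HasArc m α (-τ) τ (r, φ₀) (r, φ₁)
        (ENNReal.ofReal (2 * jacobi m α r * Real.sin ((1 - α / 2) * |φ₁ - φ₀| / 2))) := by
  wlog hle : φ₀ ≤ φ₁ generalizing φ₀ φ₁
  · rw [abs_sub_comm] at hφ ⊢
    obtain ⟨τ, hτ, hτr, harc⟩ := this hφ (le_of_not_ge hle)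
    exact ⟨τ, hτ, hτr, by simpa only [neg_neg] using harc.reverse⟩
  have hβ : 0 < 1 - α / 2 := by linarith
  obtain ⟨τ, hτ, hτr, harc⟩ := exists_hasArc_sector hm hα hα2 hr
    (ω := (1 - α / 2) * |φ₁ - φ₀| / 2) (by positivity) (by linarith) ((φ₀ + φ₁) / 2)
  refine ⟨τ, hτ, hτr, ?_⟩
  have hhalf : (1 - α / 2) * |φ₁ - φ₀| / 2 / (1 - α / 2) = (φ₁ - φ₀) / 2 := by
    rw [abs_of_nonneg (sub_nonneg.2 hle), mul_div_assoc, mul_div_cancel_left₀ _ hβ.ne']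
  rw [hhalf] at harc
  convert harc using 2 <;> ring

theorem stretch_excess_le {T s τ L : ℝ} (hT : 0 < T) (hs : 0 ≤ s) (hL : 0 ≤ L) (hτ : 0 ≤ τ)
    (hτL : τ ≤ L * s) (hsT : (1 + L) * s ≤ T / 2) :
    (T - τ) / (T - s) + (T - s) / (T - τ) - 2 ≤ 4 * (1 + L) ^ 2 * (s / T) ^ 2 := by
  have : 0 ≤ L * s := by positivity
  have hTs : T / 2 ≤ T - s := by linarith
  have hTτ : T / 2 ≤ T - τ := by linarith
  have hTs0 : 0 < T - s := by linarith
  have hTτ0 : 0 < T - τ := by linarith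
  have hsq : (s - τ) ^ 2 ≤ ((1 + L) * s) ^ 2 := sq_le_sq' (by linarith) (by linarith)
  calc (T - τ) / (T - s) + (T - s) / (T - τ) - 2 = (s - τ) ^ 2 / ((T - s) * (T - τ)) := by
        field_simp
        ring
    _ ≤ ((1 + L) * s) ^ 2 / (T / 2 * (T / 2)) := by gcongr
    _ = 4 * (1 + L) ^ 2 * (s / T) ^ 2 := by
        field_simp
        ring

theorem rbar_rpow_div (hm : 0 < m) (hα : 0 < α) {s : ℝ} (hs : 0 < s) :
    rbar m α s ^ (1 + α / 2) / (√(2 * m / α) * (1 - α / 2)) = (α + 2) / (2 - α) * s := by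
  have : 0 < √(2 * m / α) := Real.sqrt_pos.2 (by positivity)
  rw [rbar_rpow hm hα hs, show 2 / (α + 2) * (1 + α / 2) = 1 by field_simp; ring, Real.rpow_one,
    mu_eq hα, show 1 - α / 2 = (2 - α) / 2 by ring]
  field_simp

theorem exists_pos_stretch_const_mul_eq {T L S : ℝ} (hT : 0 < T) (hL : 0 < L) (hS0 : 0 ≤ S)
    (hS1 : S < 1) :
    ∃ s > 0, 4 * (1 + L) ^ 2 * (s / T) = 1 - S ∧ (1 + L) * s ≤ T / 2 := by
  refine ⟨T * (1 - S) / (4 * (1 + L) ^ 2), div_pos (mul_pos hT (sub_pos.2 hS1)) (by positivity),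
    by field_simp, ?_⟩
  rw [← mul_div_assoc, div_le_iff₀ (by positivity)]
  nlinarith [mul_pos hT hL, mul_pos hT (pow_pos hL 2)]

-- The chord at distance `rbar s` from the collision gains a fixed fraction of `jacobi (rbar s)`,
-- which is at least of order `s`, while fitting it into the time interval costs only `O(s ^ 2)`.
theorem exists_mem_GammaStar_action_lt {T φm φp : ℝ} (hm : 0 < m) (hα : 0 < α) (hα2 : α < 2)
    (hT : 0 < T) (hφ : (1 - α / 2) * |φp - φm| < Real.pi) :
    ∃ x ∈ GammaStar m α T φm φp,
      action m α T x < ENNReal.ofReal (2 * jacobi m α (rbar m α T)) := by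
  obtain ⟨L, hL⟩ : ∃ L, L = (α + 2) / (2 - α) := ⟨_, rfl⟩
  have hL0 : 0 < L := hL ▸ div_pos (by linarith) (by linarith)
  obtain ⟨S, hS⟩ : ∃ S, S = Real.sin ((1 - α / 2) * |φp - φm| / 2) := ⟨_, rfl⟩
  have hω0 : 0 ≤ (1 - α / 2) * |φp - φm| / 2 := by
    have : 0 ≤ 1 - α / 2 := by linarith
    positivity
  have hS0 : 0 ≤ S := hS ▸ Real.sin_nonneg_of_nonneg_of_le_pi hω0 (by linarith)
  have hS1 : S < 1 := by
    rw [hS]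
    refine lt_of_lt_of_eq ?_ Real.sin_pi_div_two
    exact Real.sin_lt_sin_of_lt_of_le_pi_div_two (by linarith) le_rfl (by linarith)
  obtain ⟨s, hs0, hsmall, hLs⟩ := exists_pos_stretch_const_mul_eq hT hL0 hS0 hS1
  have hsL : s ≤ (1 + L) * s := le_mul_of_one_le_left hs0.le (by linarith)
  have hr := rbar_pos hm hα hs0
  obtain ⟨τ, hτ, hτs, harc⟩ := exists_hasArc_of_angle_lt_pi hm hα hα2 hr hφ
  rw [rbar_rpow_div hm hα hs0, ← hL] at hτs
  have hJs := jacobi_pos hm hα hα2 hr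
  obtain ⟨x, hx, hxA⟩ := harc.exists_mem_GammaStar_of_radial (T := T) hm hα hα2 hτ (by linarith) hs0
    (by linarith) (mul_nonneg (by positivity) (hS ▸ hS0))
  refine ⟨x, hx, hxA.trans_lt ?_⟩
  have hJ := jacobi_rbar_le_jacobi_rbar hm hα hα2 hs0 (by linarith : s ≤ T)
  have hconc := div_mul_jacobi_rbar_le hm hα hα2 hs0 (by linarith : s ≤ T)
  have hE := stretch_excess_le hT hs0.le hL0.le hτ hτs hLs
  rw [← hS]
  generalize (T - τ) / (T - s) + (T - s) / (T - τ) = E at *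
  generalize jacobi m α (rbar m α s) = Js at *
  generalize jacobi m α (rbar m α T) = JT at *
  have hloss : (E - 2) * (JT - Js) ≤ (1 - S) * Js := calc
    (E - 2) * (JT - Js) ≤ 4 * (1 + L) ^ 2 * (s / T) ^ 2 * JT := by
      gcongr
      linarith
    _ = (1 - S) * (s / T * JT) := by
      rw [← hsmall]
      ring
    _ ≤ (1 - S) * Js := by gcongr
  refine (ENNReal.ofReal_lt_ofReal_iff (by linarith)).2 ?_
  linarith [mul_pos (sub_pos.2 hS1) hJs]

end Comparison

/-! ### The Euler-Lagrange equation -/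

/-- The force field `-m z / |z|^(α + 2)`, the right-hand side of the equation of motion. -/
def force (m α : ℝ) (z : ℂ) : ℂ := -(m / ‖z‖ ^ (α + 2)) • z

section EulerLagrange

variable {m α T : ℝ}

theorem continuousAt_force {z : ℂ} (hz : z ≠ 0) : ContinuousAt (force m α) z := by
  have hpow : ContinuousAt (fun z : ℂ => ‖z‖ ^ (α + 2)) z :=
    continuous_norm.continuousAt.rpow_const (Or.inl (norm_ne_zero_iff.2 hz))
  exact ((continuousAt_const.div hpow (Real.rpow_pos_of_pos (norm_pos_iff.2 hz) _).ne').neg).smul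
    continuousAt_id

theorem norm_force_le {δ B : ℝ} (hα : 0 ≤ α) (hδ : 0 < δ) {z : ℂ} (hδz : δ ≤ ‖z‖)
    (hzB : ‖z‖ ≤ B) : ‖force m α z‖ ≤ |m| / δ ^ (α + 2) * B := by
  rw [force, norm_smul, norm_neg, norm_div, Real.norm_eq_abs,
    Real.norm_of_nonneg (Real.rpow_nonneg (norm_nonneg z) _)]
  gcongr

theorem continuousOn_force_comp {X : Type*} [TopologicalSpace X] {s : Set X} {f : X → ℂ}
    (hf : ContinuousOn f s) (h0 : ∀ t ∈ s, f t ≠ 0) :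
    ContinuousOn (fun t => force m α (f t)) s := fun t ht =>
  (continuousAt_force (h0 t ht)).comp_continuousWithinAt (hf t ht)

theorem continuousOn_potential_comp {X : Type*} [TopologicalSpace X] {s : Set X} {f : X → ℂ}
    (hf : ContinuousOn f s) (h0 : ∀ t ∈ s, f t ≠ 0) :
    ContinuousOn (fun t => m / α / ‖f t‖ ^ α) s :=
  continuousOn_const.div (hf.norm.rpow_const fun t ht => Or.inl (norm_ne_zero_iff.2 (h0 t ht)))
    fun t ht => (Real.rpow_pos_of_pos (norm_pos_iff.2 (h0 t ht)) _).ne'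

theorem hasDerivAt_potential (hα : α ≠ 0) {z h : ℂ} {e : ℝ} (hz : z + (e : ℂ) * h ≠ 0) :
    HasDerivAt (fun e : ℝ => m / α / ‖z + (e : ℂ) * h‖ ^ α)
      (inner ℝ (force m α (z + (e : ℂ) * h)) h) e := by
  have hpos : 0 < ‖z + (e : ℂ) * h‖ := norm_pos_iff.2 hz
  have hline : HasDerivAt (fun e : ℝ => z + (e : ℂ) * h) h e := by
    simpa using ((Complex.ofRealCLM.hasDerivAt (x := e)).mul_const h).const_add z
  have hpow : ∀ (w : ℂ) (q : ℝ), (‖w‖ ^ 2) ^ q = ‖w‖ ^ (2 * q) := fun w q => by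
    rw [← Real.rpow_natCast, ← Real.rpow_mul (norm_nonneg w), Nat.cast_ofNat]
  have heq : (fun e : ℝ => m / α / ‖z + (e : ℂ) * h‖ ^ α) =
      fun e : ℝ => m / α * (‖z + (e : ℂ) * h‖ ^ 2) ^ (-(α / 2)) := by
    funext e
    rw [hpow, show 2 * -(α / 2) = -α by ring, Real.rpow_neg (norm_nonneg _), div_eq_mul_inv]
  rw [heq]
  refine ((hline.norm_sq.rpow_const (p := -(α / 2)) (Or.inl (by positivity))).const_mul
    (m / α)).congr_deriv ?_
  rw [hpow, show 2 * (-(α / 2) - 1) = -(α + 2) by ring, Real.rpow_neg hpos.le, force,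
    real_inner_smul_left]
  field_simp

theorem exists_norm_mul_add_le {X : Type*} [TopologicalSpace X] {K : Set X} (hK : IsCompact K)
    {f g : X → ℂ} (hf : ContinuousOn f K) (hg : ContinuousOn g K) (h0 : ∀ t ∈ K, f t ≠ 0) :
    ∃ δ > 0, ∀ᶠ e : ℝ in 𝓝 0, ∀ t ∈ K, ‖(e : ℂ) * g t‖ + δ ≤ ‖f t‖ := by
  obtain ⟨d, hd, hdf⟩ := hK.exists_forall_le' hf.norm fun t ht => norm_pos_iff.2 (h0 t ht)
  obtain ⟨N, hN⟩ := hK.exists_bound_of_continuousOn hg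
  have hsmall : ∀ᶠ e : ℝ in 𝓝 0, |e| * N < d / 2 :=
    (show Continuous fun e : ℝ => |e| * N by fun_prop).continuousAt.eventually_lt_const
      (by simpa using half_pos hd)
  refine ⟨d / 2, half_pos hd, hsmall.mono fun e he t ht => ?_⟩
  have hmul : ‖(e : ℂ) * g t‖ ≤ |e| * N := by
    rw [norm_mul, Complex.norm_real, Real.norm_eq_abs]
    exact mul_le_mul_of_nonneg_left (hN t ht) (abs_nonneg e)
  linarith [hdf t ht]

theorem hasDerivAt_integral_potential (hα : 0 < α) {K : Set ℝ} (hK : IsCompact K) {f g : ℝ → ℂ}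
    (hf : ContinuousOn f K) (hg : ContinuousOn g K) (h0 : ∀ t ∈ K, f t ≠ 0) :
    HasDerivAt (fun e : ℝ => ∫ t in K, m / α / ‖f t + (e : ℂ) * g t‖ ^ α)
      (∫ t in K, inner ℝ (force m α (f t)) (g t)) 0 := by
  obtain ⟨δ, hδ, hev⟩ := exists_norm_mul_add_le hK hf hg h0
  obtain ⟨B, hB⟩ := hK.exists_bound_of_continuousOn hf
  obtain ⟨N, hN⟩ := hK.exists_bound_of_continuousOn hg
  obtain ⟨U, hU, hUδ⟩ := eventually_iff_exists_mem.1 hev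
  have hlow : ∀ e ∈ U, ∀ t ∈ K, δ ≤ ‖f t + (e : ℂ) * g t‖ := fun e he t ht => by
    linarith [hUδ e he t ht, norm_sub_le_norm_add (f t) ((e : ℂ) * g t)]
  have hne : ∀ e ∈ U, ∀ t ∈ K, f t + (e : ℂ) * g t ≠ 0 := fun e he t ht =>
    norm_pos_iff.1 (hδ.trans_le (hlow e he t ht))
  have hcont : ∀ e ∈ U, ContinuousOn (fun t => m / α / ‖f t + (e : ℂ) * g t‖ ^ α) K :=
    fun e he => continuousOn_potential_comp (hf.add (continuousOn_const.mul hg)) (hne e he)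
  have hbound : ∀ t ∈ K, ∀ e ∈ U, ‖inner ℝ (force m α (f t + (e : ℂ) * g t)) (g t)‖ ≤
      |m| / δ ^ (α + 2) * (2 * B) * N := fun t ht e he => by
    have hup : ‖f t + (e : ℂ) * g t‖ ≤ 2 * B := by
      linarith [norm_add_le (f t) ((e : ℂ) * g t), hUδ e he t ht, hB t ht]
    have hforce := norm_force_le (m := m) hα.le hδ (hlow e he t ht) hup
    exact (norm_inner_le_norm _ _).trans
      (mul_le_mul hforce (hN t ht) (norm_nonneg _) ((norm_nonneg _).trans hforce))
  have : IsFiniteMeasure (volume.restrict K) := ⟨by simpa using hK.measure_lt_top⟩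
  have hderiv := (hasDerivAt_integral_of_dominated_loc_of_deriv_le (μ := volume.restrict K)
    (F' := fun (e : ℝ) t => inner ℝ (force m α (f t + (e : ℂ) * g t)) (g t)) hU
    (mem_of_superset hU fun e he => (hcont e he).aestronglyMeasurable hK.measurableSet)
    ((hcont 0 (mem_of_mem_nhds hU)).integrableOn_compact hK)
    (ContinuousOn.aestronglyMeasurable ((continuousOn_force_comp
      (hf.add (continuousOn_const.mul hg)) (hne 0 (mem_of_mem_nhds hU))).inner hg)
      hK.measurableSet)
    ((ae_restrict_iff' hK.measurableSet).2 (ae_of_all _ hbound)) (integrable_const _)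
    ((ae_restrict_iff' hK.measurableSet).2 (ae_of_all _ fun t ht e he =>
      hasDerivAt_potential hα.ne' (hne e he t ht)))).2
  simpa only [Complex.ofReal_zero, zero_mul, add_zero] using hderiv

theorem vel_add (x y : H1Curve T) : vel (x + y) = vel x + vel y :=
  (MemLp.toLp_congr _ _ (deriv_add_ae x.2 y.2)).trans (MemLp.toLp_add _ _)

theorem vel_smul (c : ℂ) (x : H1Curve T) : vel (c • x) = c • vel x :=
  (MemLp.toLp_congr _ _ (deriv_smul_ae c x.2)).trans (MemLp.toLp_const_smul _ _)

theorem re_inner_vel (x y : H1Curve T) :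
    (inner ℂ (vel x) (vel y) : ℂ).re =
      ∫ t in Icc (-T) T, inner ℝ (deriv (x : ℝ → ℂ) t) (deriv (y : ℝ → ℂ) t) := by
  rw [L2.inner_def, ← RCLike.re_eq_complex_re,
    ← integral_re (L2.integrable_inner (𝕜 := ℂ) (vel x) (vel y))]
  refine integral_congr_ae ?_
  filter_upwards [coeFn_vel x, coeFn_vel y] with t hx hy
  rw [hx, hy]
  rfl

theorem norm_vel_add_smul_sq (x y : H1Curve T) (e : ℝ) :
    ‖vel (x + (e : ℂ) • y)‖ ^ 2 =
      ‖vel x‖ ^ 2 + 2 * e * (inner ℂ (vel x) (vel y) : ℂ).re + e ^ 2 * ‖vel y‖ ^ 2 := by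
  rw [vel_add, vel_smul, norm_add_sq (𝕜 := ℂ), inner_smul_right, norm_smul]
  simp [mul_pow]
  ring

theorem action_eq_ofReal_add (hm : 0 ≤ m) (hα : 0 ≤ α) {y : H1Curve T} {K : Set ℝ}
    (hK : IsCompact K) (hKT : K ⊆ Icc (-T) T) (h0 : ∀ t ∈ K, (y : ℝ → ℂ) t ≠ 0) :
    action m α T y = ENNReal.ofReal (‖vel y‖ ^ 2 / 2 + ∫ t in K, m / α / ‖(y : ℝ → ℂ) t‖ ^ α) +
      ∫⁻ t in Icc (-T) T \ K, potential m α ((y : ℝ → ℂ) t) := by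
  have hpot : ∫⁻ t in K, potential m α ((y : ℝ → ℂ) t) =
      ENNReal.ofReal (∫ t in K, m / α / ‖(y : ℝ → ℂ) t‖ ^ α) := by
    rw [ofReal_integral_eq_lintegral_ofReal ((continuousOn_potential_comp
      (y.2.continuousOn.mono hKT) h0).integrableOn_compact hK) (ae_of_all _ fun t => by positivity)]
    exact setLIntegral_congr_fun hK.measurableSet fun t ht => potential_eq_ofReal (h0 t ht)
  rw [action_eq, ← lintegral_inter_add_sdiff (μ := volume) _ (Icc (-T) T) hK.measurableSet,
    inter_eq_right.2 hKT, hpot, ← add_assoc,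
    ← ENNReal.ofReal_add (by positivity) (integral_nonneg fun t => by positivity)]

theorem eventually_action_add_smul (hm : 0 ≤ m) (hα : 0 ≤ α) {x z : H1Curve T} {K : Set ℝ}
    (hK : IsCompact K) (hKT : K ⊆ Icc (-T) T) (h0 : ∀ t ∈ K, (x : ℝ → ℂ) t ≠ 0)
    (hz : ∀ t ∈ Icc (-T) T \ K, (z : ℝ → ℂ) t = 0) :
    ∀ᶠ e : ℝ in 𝓝 0, action m α T (x + (e : ℂ) • z : H1Curve T) =
      ENNReal.ofReal ((‖vel x‖ ^ 2 + 2 * e * (inner ℂ (vel x) (vel z) : ℂ).re +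
        e ^ 2 * ‖vel z‖ ^ 2) / 2 +
          ∫ t in K, m / α / ‖(x : ℝ → ℂ) t + (e : ℂ) * (z : ℝ → ℂ) t‖ ^ α) +
        ∫⁻ t in Icc (-T) T \ K, potential m α ((x : ℝ → ℂ) t) := by
  obtain ⟨δ, hδ, hev⟩ := exists_norm_mul_add_le hK (x.2.continuousOn.mono hKT)
    (z.2.continuousOn.mono hKT) h0
  filter_upwards [hev] with e he
  have hne : ∀ t ∈ K, ((x + (e : ℂ) • z : H1Curve T) : ℝ → ℂ) t ≠ 0 := fun t ht h => by
    have hnorm : ‖(e : ℂ) * (z : ℝ → ℂ) t‖ = ‖(x : ℝ → ℂ) t‖ := by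
      rw [eq_neg_of_add_eq_zero_left (b := (e : ℂ) * (z : ℝ → ℂ) t) h, norm_neg]
    linarith [he t ht]
  rw [action_eq_ofReal_add hm hα hK hKT hne, norm_vel_add_smul_sq]
  congr 1
  refine setLIntegral_congr_fun (measurableSet_Icc.diff hK.measurableSet) fun t ht => ?_
  simp [hz t ht]

theorem first_variation (hm : 0 ≤ m) (hα : 0 < α) {x z : H1Curve T}
    (hfin : action m α T x ≠ ⊤) {K : Set ℝ} (hK : IsCompact K) (hKT : K ⊆ Icc (-T) T)
    (h0 : ∀ t ∈ K, (x : ℝ → ℂ) t ≠ 0) (hz : ∀ t ∈ Icc (-T) T \ K, (z : ℝ → ℂ) t = 0)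
    (hmin : ∀ᶠ e : ℝ in 𝓝 0, action m α T x ≤ action m α T (x + (e : ℂ) • z : H1Curve T)) :
    (∫ t in Icc (-T) T, inner ℝ (deriv (x : ℝ → ℂ) t) (deriv (z : ℝ → ℂ) t)) +
      ∫ t in K, inner ℝ (force m α ((x : ℝ → ℂ) t)) ((z : ℝ → ℂ) t) = 0 := by
  let kin : ℝ → ℝ := fun e => (‖vel x‖ ^ 2 + 2 * e * (inner ℂ (vel x) (vel z) : ℂ).re +
    e ^ 2 * ‖vel z‖ ^ 2) / 2
  let pot : ℝ → ℝ := fun e => ∫ t in K, m / α / ‖(x : ℝ → ℂ) t + (e : ℂ) * (z : ℝ → ℂ) t‖ ^ α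
  have haction := eventually_action_add_smul hm hα.le hK hKT h0 hz
  have hzero : action m α T x = ENNReal.ofReal (kin 0 + pot 0) +
      ∫⁻ t in Icc (-T) T \ K, potential m α ((x : ℝ → ℂ) t) := by
    simpa [kin, pot] using haction.self_of_nhds
  have hlocal : IsLocalMin (fun e => kin e + pot e) 0 := by
    filter_upwards [hmin, haction] with e hmin he
    have hnonneg : 0 ≤ kin e + pot e :=
      add_nonneg (by simp only [kin]; rw [← norm_vel_add_smul_sq]; positivity)
        (integral_nonneg fun t => by positivity)
    rw [he, hzero] at hmin
    exact (ENNReal.ofReal_le_ofReal_iff hnonneg).1 (ENNReal.le_of_add_le_add_right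
      (ne_top_of_le_ne_top hfin (hzero ▸ le_add_self)) hmin)
  have hkin : HasDerivAt kin (inner ℂ (vel x) (vel z) : ℂ).re 0 := by
    refine (((((hasDerivAt_const_mul (2 : ℝ)).mul_const _).const_add (‖vel x‖ ^ 2)).add
      ((hasDerivAt_pow 2 (0 : ℝ)).mul_const (‖vel z‖ ^ 2))).div_const 2).congr_deriv ?_
    norm_num
  have hpot : HasDerivAt pot
      (∫ t in K, inner ℝ (force m α ((x : ℝ → ℂ) t)) ((z : ℝ → ℂ) t)) 0 :=
    hasDerivAt_integral_potential hα hK (x.2.continuousOn.mono hKT) (z.2.continuousOn.mono hKT) h0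
  rw [← re_inner_vel]
  exact hlocal.hasDerivAt_eq_zero (hkin.add hpot)

end EulerLagrange

/-! ### Weak solutions -/

theorem integral_inner_add_inner_deriv {a b : ℝ} {f g : ℝ → ℂ}
    (hf : AbsolutelyContinuousOnInterval f a b) (hg : AbsolutelyContinuousOnInterval g a b) :
    ∫ t in a..b, (inner ℝ (f t) (deriv g t) + inner ℝ (deriv f t) (g t)) =
      inner ℝ (f b) (g b) - inner ℝ (f a) (g a) := by
  have hconj : AbsolutelyContinuousOnInterval (fun t => star (f t)) a b :=
    absCont_of_dist_le_mul hf 1 fun s _ t _ => by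
      rw [one_mul, dist_eq_norm, dist_eq_norm, ← star_sub, norm_star]
  have hinner : AbsolutelyContinuousOnInterval (fun t => inner ℝ (f t) (g t)) a b :=
    absCont_of_dist_le_mul (hg.smul hconj) 1 fun s _ t _ => by
      rw [one_mul, Real.dist_eq, dist_eq_norm]
      exact Complex.abs_re_le_norm (g s * star (f s) - g t * star (f t))
  rw [← hinner.integral_deriv_eq_sub]
  refine intervalIntegral.integral_congr_ae ?_
  filter_upwards [ae_differentiableAt_of_absCont_uIcc hf,
    ae_differentiableAt_of_absCont_uIcc hg] with t hft hgt ht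
  exact ((hft (uIoc_subset_uIcc ht)).hasDerivAt.inner ℝ
    (hgt (uIoc_subset_uIcc ht)).hasDerivAt).deriv.symm

theorem integrable_inner_of_memLp {X : Type*} [MeasurableSpace X] {μ : Measure X} {f g : X → ℂ}
    (hf : MemLp f 2 μ) (hg : MemLp g 2 μ) : Integrable (fun t => inner ℝ (f t) (g t)) μ := by
  refine (L2.integrable_inner (𝕜 := ℝ) (hf.toLp f) (hg.toLp g)).congr ?_
  filter_upwards [hf.coeFn_toLp, hg.coeFn_toLp] with t hft hgt
  rw [hft, hgt]

theorem memH1_of_contDiff {T : ℝ} {q : ℝ → ℂ} (hq : ContDiff ℝ 1 q) : MemH1 T q :=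
  ⟨hq.contDiffOn.absolutelyContinuousOnInterval,
    memLp_two_of_continuousOn (hq.continuous_deriv le_rfl).continuousOn⟩

theorem indicator_eq_integral {T : ℝ} {y : ℝ → ℂ} (hy : MemH1 T y) {a b : ℝ}
    (ha : a ∈ Icc (-T) T) (hb : b ∈ Icc (-T) T) (hab : a ≤ b) (hya : y a = 0) (hyb : y b = 0)
    {t : ℝ} (ht : t ∈ Icc (-T) T) :
    (Icc a b).indicator y t = ∫ u in (-T)..t, (Ioc a b).indicator (deriv y) u := by
  rw [intervalIntegral.integral_of_le ht.1, setIntegral_indicator measurableSet_Ioc,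
    Ioc_inter_Ioc, max_eq_right ha.1]
  rcases lt_or_ge t a with hta | hat
  · rw [Ioc_eq_empty (not_lt.2 ((min_le_left _ _).trans hta.le)), setIntegral_empty,
      indicator_of_notMem fun h : t ∈ Icc a b => hta.not_ge h.1]
  rw [← intervalIntegral.integral_of_le (le_min hat hab)]
  rcases le_or_gt t b with htb | hbt
  · rw [min_eq_left htb, hy.sub_eq_integral ha ht, hya, sub_zero,
      indicator_of_mem (mem_Icc.2 ⟨hat, htb⟩)]
  · rw [min_eq_right hbt.le, hy.sub_eq_integral ha hb, hya, hyb, sub_zero,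
      indicator_of_notMem fun h : t ∈ Icc a b => hbt.not_ge h.2]

theorem memH1_indicator {T : ℝ} (hT : 0 < T) {y : ℝ → ℂ} (hy : MemH1 T y) {a b : ℝ}
    (ha : a ∈ Icc (-T) T) (hb : b ∈ Icc (-T) T) (hab : a ≤ b) (hya : y a = 0) (hyb : y b = 0) :
    MemH1 T ((Icc a b).indicator y) ∧
      deriv ((Icc a b).indicator y) =ᵐ[timeMeasure T] (Ioc a b).indicator (deriv y) := by
  have hv := hy.memLp_deriv.indicator (measurableSet_Ioc (a := a) (b := b))
  have hx : ∀ t ∈ Icc (-T) T, (Icc a b).indicator y t =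
      0 + ∫ u in (-T)..t, (Ioc a b).indicator (deriv y) u := fun t ht => by
    rw [zero_add, indicator_eq_integral hy ha hb hab hya hyb ht]
  exact ⟨memH1_of_eq_integral hT hv hx, deriv_ae_eq_of_eq_integral hv hx⟩

theorem exists_second_primitive {E : Type*} [NormedAddCommGroup E] [NormedSpace ℝ E]
    [CompleteSpace E] {g : ℝ → E} (hg : Continuous g) {a b : ℝ} (hab : a ≠ b) (u w : E) :
    ∃ q q' : ℝ → E, (∀ t, HasDerivAt q (q' t) t) ∧ (∀ t, HasDerivAt q' (g t) t) ∧
      q a = u ∧ q b = w := by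
  have hprim : ∀ {f : ℝ → E}, Continuous f → ∀ t, HasDerivAt (fun t => ∫ s in a..t, f s) (f t) t :=
    fun hf t => hf.integral_hasStrictDerivAt a t |>.hasDerivAt
  let p : ℝ → E := fun t => ∫ s in a..t, g s
  have hp : Continuous p := continuous_iff_continuousAt.2 fun t => (hprim hg t).continuousAt
  let c : E := (b - a)⁻¹ • (w - u - ∫ s in a..b, p s)
  refine ⟨fun t => u + ((∫ s in a..t, p s) + (t - a) • c), fun t => p t + c, fun t => ?_,
    fun t => (hprim hg t).add_const c, by simp, ?_⟩
  · have hlin : HasDerivAt (fun t : ℝ => (t - a) • c) c t := by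
      simpa using ((hasDerivAt_id t).sub_const a).smul_const c
    exact ((hprim hp t).add hlin).const_add u
  · simp only [c]
    rw [smul_inv_smul₀ (sub_ne_zero.2 hab.symm)]
    abel

theorem eq_apply_left_of_norm_vel_eq_zero {T : ℝ} {z : H1Curve T} (hz : ‖vel z‖ = 0) {t : ℝ}
    (ht : t ∈ Icc (-T) T) : (z : ℝ → ℂ) t = (z : ℝ → ℂ) (-T) := by
  have hle := norm_sub_le_sqrt z (left_mem_Icc.2 (ht.1.trans ht.2)) ht
  rw [hz, mul_zero] at hle
  exact sub_eq_zero.1 (norm_le_zero_iff.1 hle)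

theorem integral_inner_deriv_eq_neg {T : ℝ} (hT : 0 ≤ T) {q z : ℝ → ℂ} (hq : MemH1 T q)
    (hz : MemH1 T z) (hl : z (-T) = 0) (hr : z T = 0) :
    ∫ t in Icc (-T) T, inner ℝ (q t) (deriv z t) =
      -∫ t in Icc (-T) T, inner ℝ (deriv q t) (z t) := by
  have hparts := integral_inner_add_inner_deriv hq.absCont hz.absCont
  rw [intervalIntegral.integral_of_le (by linarith), ← integral_Icc_eq_integral_Ioc,
    integral_add (integrable_inner_of_memLp hq.memLp hz.memLp_deriv)
      (integrable_inner_of_memLp hq.memLp_deriv hz.memLp), hl, hr, inner_zero_right,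
    inner_zero_right, sub_zero] at hparts
  exact eq_neg_of_add_eq_zero_left hparts

theorem norm_vel_sq_of_deriv_ae_eq_indicator {T : ℝ} (hT : 0 ≤ T) {x z : H1Curve T} {q : ℝ → ℂ}
    {s : Set ℝ} (hq : MemH1 T q) (hq' : MemH1 T (deriv q)) (hl : (z : ℝ → ℂ) (-T) = 0)
    (hr : (z : ℝ → ℂ) T = 0)
    (hz : deriv (z : ℝ → ℂ) =ᵐ[timeMeasure T] s.indicator (deriv (q - (x : ℝ → ℂ)))) :
    ‖vel z‖ ^ 2 = -(∫ t in Icc (-T) T, inner ℝ (deriv (deriv q) t) ((z : ℝ → ℂ) t)) -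
      ∫ t in Icc (-T) T, inner ℝ (deriv (x : ℝ → ℂ) t) (deriv (z : ℝ → ℂ) t) := by
  have hpointwise : ∀ᵐ t ∂timeMeasure T, ‖deriv (z : ℝ → ℂ) t‖ ^ 2 =
      inner ℝ (deriv q t) (deriv (z : ℝ → ℂ) t) -
        inner ℝ (deriv (x : ℝ → ℂ) t) (deriv (z : ℝ → ℂ) t) := by
    filter_upwards [hz, ae_differentiableAt_of_absCont hq.absCont,
      ae_differentiableAt_of_absCont x.2.absCont] with t ht hqt hxt
    rw [← inner_sub_left, ← real_inner_self_eq_norm_sq, ht, ← deriv_sub hqt hxt]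
    by_cases hts : t ∈ s
    · rw [indicator_of_mem hts]
    · rw [indicator_of_notMem hts, inner_zero_right, inner_zero_right]
  rw [norm_vel_sq, integral_congr_ae hpointwise,
    integral_sub (integrable_inner_of_memLp hq'.memLp z.2.memLp_deriv)
      (integrable_inner_of_memLp x.2.memLp_deriv z.2.memLp_deriv),
    integral_inner_deriv_eq_neg hT hq' z.2 hl hr]

-- The test function is `q - x`, cut off outside `[a, b]`.
theorem eqOn_of_weak_solution {T : ℝ} (hT : 0 < T) (x : H1Curve T) {a b : ℝ}
    (ha : a ∈ Icc (-T) T) (hb : b ∈ Icc (-T) T) (hab : a ≤ b) {q : ℝ → ℂ} (hq : ContDiff ℝ 2 q)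
    (hqa : q a = (x : ℝ → ℂ) a) (hqb : q b = (x : ℝ → ℂ) b)
    (hweak : ∀ z : H1Curve T, (z : ℝ → ℂ) (-T) = 0 → (z : ℝ → ℂ) T = 0 →
      (∀ t ∉ Icc a b, (z : ℝ → ℂ) t = 0) →
      (∫ t in Icc (-T) T, inner ℝ (deriv (x : ℝ → ℂ) t) (deriv (z : ℝ → ℂ) t)) +
        ∫ t in Icc a b, inner ℝ (deriv (deriv q) t) ((z : ℝ → ℂ) t) = 0) :
    EqOn x q (Icc a b) := by
  have hsub : Icc a b ⊆ Icc (-T) T := Icc_subset_Icc ha.1 hb.2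
  have hqH : MemH1 T q := memH1_of_contDiff (hq.of_le (by norm_num))
  have hq' : MemH1 T (deriv q) := memH1_of_contDiff ((contDiff_succ_iff_deriv (n := 1)).1 hq).2.2
  have hqxa : (q - (x : ℝ → ℂ)) a = 0 := sub_eq_zero.2 hqa
  have hqxb : (q - (x : ℝ → ℂ)) b = 0 := sub_eq_zero.2 hqb
  obtain ⟨hz, hz'⟩ := memH1_indicator hT ((H1Curve T).sub_mem hqH x.2) ha hb hab hqxa hqxb
  let z : H1Curve T := ⟨(Icc a b).indicator (q - (x : ℝ → ℂ)), hz⟩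
  have hzout : ∀ t ∉ Icc a b, (z : ℝ → ℂ) t = 0 := fun t ht => indicator_of_notMem ht _
  have hzl : (z : ℝ → ℂ) (-T) = 0 := indicator_apply_eq_zero.2 fun h =>
    h.1.antisymm ha.1 ▸ hqxa
  have hzr : (z : ℝ → ℂ) T = 0 := indicator_apply_eq_zero.2 fun h =>
    hb.2.antisymm h.2 ▸ hqxb
  have hsplit : ∫ t in Icc (-T) T, inner ℝ (deriv (deriv q) t) ((z : ℝ → ℂ) t) =
      ∫ t in Icc a b, inner ℝ (deriv (deriv q) t) ((z : ℝ → ℂ) t) :=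
    setIntegral_eq_of_subset_of_forall_sdiff_eq_zero measurableSet_Icc hsub
      fun t ht => by rw [hzout t ht.2, inner_zero_right]
  have henergy : ‖vel z‖ ^ 2 = 0 := by
    rw [norm_vel_sq_of_deriv_ae_eq_indicator hT.le hqH hq' hzl hzr hz', hsplit]
    linarith [hweak z hzl hzr hzout]
  intro t ht
  have hzt : (z : ℝ → ℂ) t = 0 :=
    (eq_apply_left_of_norm_vel_eq_zero (pow_eq_zero_iff two_ne_zero |>.1 henergy)
      (hsub ht)).trans hzl
  exact (sub_eq_zero.1 ((indicator_of_mem ht (q - (x : ℝ → ℂ))).symm.trans hzt)).symm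

theorem exists_hasDerivAt_of_weak_solution {T : ℝ} (hT : 0 < T) (x : H1Curve T) {a b : ℝ}
    (ha : a ∈ Icc (-T) T) (hb : b ∈ Icc (-T) T) (hab : a < b) {g : ℝ → ℂ}
    (hg : ContinuousOn g (Icc a b))
    (hweak : ∀ z : H1Curve T, (z : ℝ → ℂ) (-T) = 0 → (z : ℝ → ℂ) T = 0 →
      (∀ t ∉ Icc a b, (z : ℝ → ℂ) t = 0) →
      (∫ t in Icc (-T) T, inner ℝ (deriv (x : ℝ → ℂ) t) (deriv (z : ℝ → ℂ) t)) +
        ∫ t in Icc a b, inner ℝ (g t) ((z : ℝ → ℂ) t) = 0) :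
    ∃ q q' : ℝ → ℂ, EqOn x q (Icc a b) ∧ (∀ t, HasDerivAt q (q' t) t) ∧
      ∀ t ∈ Icc a b, HasDerivAt q' (g t) t := by
  let G : ℝ → ℂ := IccExtend hab.le ((Icc a b).domRestrict g)
  have hG : Continuous G := (continuousOn_iff_continuous_domRestrict.1 hg).Icc_extend'
  have hGg : EqOn G g (Icc a b) := fun t ht => IccExtend_of_mem _ _ ht
  obtain ⟨q, q', hq, hq', hqa, hqb⟩ :=
    exists_second_primitive hG hab.ne ((x : ℝ → ℂ) a) ((x : ℝ → ℂ) b)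
  obtain rfl : deriv q = q' := funext fun t => (hq t).deriv
  have hq'' : deriv (deriv q) = G := funext fun t => (hq' t).deriv
  have hqC : ContDiff ℝ 2 q := by
    refine (contDiff_succ_iff_deriv (n := 1)).2 ⟨fun t => (hq t).differentiableAt, by simp, ?_⟩
    exact contDiff_one_iff_deriv.2 ⟨fun t => (hq' t).differentiableAt, hq'' ▸ hG⟩
  refine ⟨q, deriv q, eqOn_of_weak_solution hT x ha hb hab.le hqC hqa hqb
    fun z hl hr hz => ?_, hq, fun t ht => hGg ht ▸ hq' t⟩
  rw [← hweak z hl hr hz, hq'']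
  congr 1
  exact setIntegral_congr_fun measurableSet_Icc fun t ht => by simp only [hGg ht]

/-! ### Minimizers -/

theorem exists_Icc_mem_nhdsWithin {c d t : ℝ} (hcd : c < d) (ht : t ∈ Icc c d) {U : Set ℝ}
    (hU : U ∈ 𝓝[Icc c d] t) :
    ∃ a b, a ∈ Icc c d ∧ b ∈ Icc c d ∧ a < b ∧ Icc a b ∈ 𝓝[Icc c d] t ∧ Icc a b ⊆ U := by
  obtain ⟨V, hV, hVU⟩ := mem_nhdsWithin_iff_exists_mem_nhds_inter.1 hU
  obtain ⟨a, b, -, hab, habV⟩ := exists_Icc_mem_subset_of_mem_nhds hV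
  obtain ⟨hat, htb⟩ := Icc_mem_nhds_iff.1 hab
  have heq : Icc (max a c) (min b d) = Icc a b ∩ Icc c d := Icc_inter_Icc.symm
  refine ⟨max a c, min b d, ⟨le_max_right _ _, max_le (hat.le.trans ht.2) hcd.le⟩,
    ⟨le_min (ht.1.trans htb.le) hcd.le, min_le_right _ _⟩, ?_,
    heq ▸ inter_mem (mem_nhdsWithin_of_mem_nhds hab) self_mem_nhdsWithin,
    heq ▸ (inter_subset_inter_left _ habV).trans hVU⟩
  exact max_lt (lt_min (hat.trans htb) (hat.trans_le ht.2)) (lt_min (ht.1.trans_lt htb) hcd)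

theorem isSolutionOn_of_locally {m α : ℝ} {s : Set ℝ} {x : ℝ → ℂ} (hs : UniqueDiffOn ℝ s)
    (h0 : ∀ t ∈ s, x t ≠ 0)
    (h : ∀ t ∈ s, ∃ J ∈ 𝓝[s] t, ∃ q q' : ℝ → ℂ, EqOn x q J ∧ (∀ u, HasDerivAt q (q' u) u) ∧
      HasDerivAt q' (force m α (x t)) t) :
    IsSolutionOn m α s x := by
  refine ⟨derivWithin x s, fun t ht => ?_⟩
  obtain ⟨J, hJ, q, q', hxq, hq, hq'⟩ := h t ht
  have hderiv : ∀ u ∈ s, J ∈ 𝓝[s] u → HasDerivWithinAt x (q' u) s u := fun u hu hJu =>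
    (hq u).hasDerivWithinAt.congr_of_eventuallyEq (mem_of_superset hJu hxq)
      (hxq (mem_of_mem_nhdsWithin hu hJu))
  have hvel : derivWithin x s =ᶠ[𝓝[s] t] q' := by
    filter_upwards [eventually_mem_nhdsWithin_iff.2 hJ, self_mem_nhdsWithin] with u hu hus
    exact (hderiv u hus hu).derivWithin (hs u hus)
  exact ⟨h0 t ht, (hderiv t ht hJ).differentiableWithinAt.hasDerivWithinAt,
    hq'.hasDerivWithinAt.congr_of_eventuallyEq hvel (hvel.self_of_nhdsWithin ht)⟩

section Minimizer

variable {m α T φm φp : ℝ} {x : H1Curve T}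

theorem eventually_add_smul_mem_Gamma (hT : 0 < T) (hx : x ∈ Gamma m α T φm φp) {K : Set ℝ}
    (hK : IsCompact K) (hKT : K ⊆ Icc (-T) T) (h0 : ∀ t ∈ K, (x : ℝ → ℂ) t ≠ 0) {z : H1Curve T}
    (hl : (z : ℝ → ℂ) (-T) = 0) (hr : (z : ℝ → ℂ) T = 0) (hz : ∀ t ∉ K, (z : ℝ → ℂ) t = 0) :
    ∀ᶠ e : ℝ in 𝓝 0, x + (e : ℂ) • z ∈ Gamma m α T φm φp := by
  obtain ⟨δ, hδ, hev⟩ :=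
    exists_norm_mul_add_le hK (x.2.continuousOn.mono hKT) (z.2.continuousOn.mono hKT) h0
  filter_upwards [hev] with e he
  refine add_mem_Gamma hT hx (by simp [hl]) (by simp [hr]) hδ fun t _ => ?_
  by_cases htK : t ∈ K
  · exact Or.inr (he t htK)
  · exact Or.inl (by simp [hz t htK])

theorem exists_hasDerivAt_force_of_minimizer (hm : 0 ≤ m) (hα : 0 < α) (hT : 0 < T)
    (hx : x ∈ Gamma m α T φm φp) (hfin : action m α T x ≠ ⊤)
    (hmin : ∀ y ∈ Gamma m α T φm φp, action m α T x ≤ action m α T y) {a b : ℝ}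
    (ha : a ∈ Icc (-T) T) (hb : b ∈ Icc (-T) T) (hab : a < b)
    (h0 : ∀ t ∈ Icc a b, (x : ℝ → ℂ) t ≠ 0) :
    ∃ q q' : ℝ → ℂ, EqOn x q (Icc a b) ∧ (∀ t, HasDerivAt q (q' t) t) ∧
      ∀ t ∈ Icc a b, HasDerivAt q' (force m α ((x : ℝ → ℂ) t)) t := by
  have hsub : Icc a b ⊆ Icc (-T) T := Icc_subset_Icc ha.1 hb.2
  refine exists_hasDerivAt_of_weak_solution hT x ha hb hab
    (continuousOn_force_comp (x.2.continuousOn.mono hsub) h0) fun z hl hr hz => ?_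
  exact first_variation hm hα hfin isCompact_Icc hsub h0 (fun t ht => hz t ht.2)
    ((eventually_add_smul_mem_Gamma hT hx isCompact_Icc hsub h0 hl hr hz).mono fun e he =>
      hmin _ he)

theorem isSolutionOn_of_minimizer (hm : 0 ≤ m) (hα : 0 < α) (hT : 0 < T)
    (hx : x ∈ Gamma m α T φm φp) (hfin : action m α T x ≠ ⊤)
    (hmin : ∀ y ∈ Gamma m α T φm φp, action m α T x ≤ action m α T y) :
    IsSolutionOn m α {t ∈ Icc (-T) T | (x : ℝ → ℂ) t ≠ 0} x := by
  have hlt : -T < T := by linarith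
  have hsub : {t ∈ Icc (-T) T | (x : ℝ → ℂ) t ≠ 0} ⊆ Icc (-T) T := sep_subset _ _
  have hopen : ∀ t ∈ {t ∈ Icc (-T) T | (x : ℝ → ℂ) t ≠ 0},
      {t ∈ Icc (-T) T | (x : ℝ → ℂ) t ≠ 0} ∈ 𝓝[Icc (-T) T] t := fun t ht =>
    inter_mem self_mem_nhdsWithin ((x.2.continuousOn t ht.1).eventually_ne ht.2)
  have hunique : UniqueDiffOn ℝ {t ∈ Icc (-T) T | (x : ℝ → ℂ) t ≠ 0} := fun t ht => by
    simpa only [inter_eq_right.2 hsub] using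
      (uniqueDiffOn_Icc hlt t ht.1).inter' (hopen t ht)
  refine isSolutionOn_of_locally hunique (fun t ht => ht.2) fun t ht => ?_
  obtain ⟨a, b, ha, hb, hab, hnhds, hJ⟩ := exists_Icc_mem_nhdsWithin hlt ht.1 (hopen t ht)
  obtain ⟨q, q', hxq, hq, hq'⟩ := exists_hasDerivAt_force_of_minimizer hm hα hT hx hfin hmin
    ha hb hab fun u hu => (hJ hu).2
  have hnhds' := nhdsWithin_mono t hsub hnhds
  exact ⟨Icc a b, hnhds', q, q', hxq, hq, hq' t (mem_of_mem_nhdsWithin ht hnhds')⟩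

end Minimizer

section Existence

variable {m α T φm φp : ℝ}

theorem two_jacobi_le_action_of_mem_Gamma (hm : 0 < m) (hα : 0 < α) (hα2 : α < 2) (hT : 0 < T)
    {y : H1Curve T} (hy : y ∈ Gamma m α T φm φp) {t : ℝ} (ht : t ∈ Icc (-T) T)
    (h0 : (y : ℝ → ℂ) t = 0) :
    ENNReal.ofReal (2 * jacobi m α (rbar m α T)) ≤ action m α T y := by
  obtain ⟨hl, hr⟩ := apply_of_mem_Gamma hT hy
  refine two_jacobi_le_action hm hα hα2 y.2 ?_ ?_ ht h0
  · rw [hl, norm_xbar hm hα, abs_neg, abs_of_pos hT]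
  · rw [hr, norm_xbar hm hα, abs_of_pos hT]

theorem iInf_GammaStar_le (hm : 0 < m) (hα : 0 < α) (hα2 : α < 2) (hT : 0 < T) :
    ⨅ x ∈ GammaStar m α T φm φp, action m α T x ≤
      ENNReal.ofReal (2 * jacobi m α (rbar m α T)) := by
  refine ENNReal.le_of_forall_pos_le_add fun ε hε _ => ?_
  obtain ⟨x, hx, hxa⟩ := exists_mem_GammaStar_action_le (φm := φm) (φp := φp) hm hα hα2 hT
    (NNReal.coe_pos.2 hε)
  calc ⨅ x ∈ GammaStar m α T φm φp, action m α T x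
      ≤ ENNReal.ofReal (2 * jacobi m α (rbar m α T) + ε) := (iInf₂_le x hx).trans hxa
    _ ≤ ENNReal.ofReal (2 * jacobi m α (rbar m α T)) + ENNReal.ofReal ε := ENNReal.ofReal_add_le
    _ = ENNReal.ofReal (2 * jacobi m α (rbar m α T)) + ε := by rw [ENNReal.ofReal_coe_nnreal]

theorem cbar_eq_iInf_GammaStar (hm : 0 < m) (hα : 0 < α) (hα2 : α < 2) (hT : 0 < T) :
    cbar m α T φm φp = ⨅ x ∈ GammaStar m α T φm φp, action m α T x := by
  refine le_antisymm (biInf_mono fun x hx => GammaStar_subset_Gamma hx) (le_iInf₂ fun y hy => ?_)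
  by_cases h0 : ∀ t ∈ Icc (-T) T, (y : ℝ → ℂ) t ≠ 0
  · exact iInf₂_le y (mem_GammaStar_of_mem_Gamma hT hy h0)
  · push Not at h0
    obtain ⟨t, ht, hyt⟩ := h0
    exact (iInf_GammaStar_le hm hα hα2 hT).trans
      (two_jacobi_le_action_of_mem_Gamma hm hα hα2 hT hy ht hyt)

theorem cbar_lt_top (hm : 0 < m) (hα : 0 < α) (hα2 : α < 2) (hT : 0 < T) :
    cbar m α T φm φp < ⊤ := by
  rw [cbar_eq_iInf_GammaStar hm hα hα2 hT]
  exact (iInf_GammaStar_le hm hα hα2 hT).trans_lt ENNReal.ofReal_lt_top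

theorem norm_vel_le_of_action_le {x : H1Curve T} {c : ℝ≥0∞} (hc : c ≠ ⊤)
    (hx : action m α T x ≤ c) : ‖vel x‖ ≤ √(2 * c.toReal) := by
  have hkin : ENNReal.ofReal (‖vel x‖ ^ 2 / 2) ≤ c := by
    rw [action_eq] at hx
    exact le_self_add.trans hx
  rw [ENNReal.ofReal_le_iff_le_toReal hc] at hkin
  exact Real.le_sqrt_of_sq_le (by linarith)

theorem exists_seq_tendsto_cbar (hm : 0 < m) (hα : 0 < α) (hα2 : α < 2) (hT : 0 < T) :
    ∃ x : ℕ → H1Curve T, (∀ n, x n ∈ GammaStar m α T φm φp) ∧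
      Tendsto (fun n => action m α T (x n)) atTop (𝓝 (cbar m α T φm φp)) := by
  obtain ⟨x₀, hx₀, -⟩ := exists_mem_GammaStar_action_le (φm := φm) (φp := φp) hm hα hα2 hT one_pos
  obtain ⟨u, -, hu, hux⟩ := exists_seq_tendsto_sInf (S := (fun x : H1Curve T => action m α T x) ''
    GammaStar m α T φm φp) ⟨_, x₀, hx₀, rfl⟩ (OrderBot.bddBelow _)
  rw [sInf_image, ← cbar_eq_iInf_GammaStar hm hα hα2 hT] at hu
  choose x hx hxu using hux
  exact ⟨x, hx, hu.congr fun n => (hxu n).symm⟩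

theorem exists_minimizer (hm : 0 < m) (hα : 0 < α) (hα2 : α < 2) (hT : 0 < T) :
    ∃ γ ∈ Gamma m α T φm φp, action m α T γ = cbar m α T φm φp := by
  have hfin := cbar_lt_top (φm := φm) (φp := φp) hm hα hα2 hT
  obtain ⟨x, hx, hlim⟩ := exists_seq_tendsto_cbar (φm := φm) (φp := φp) hm hα hα2 hT
  obtain ⟨N, hN⟩ := eventually_atTop.1 (hlim.eventually (gt_mem_nhds
    (ENNReal.lt_add_right hfin.ne one_ne_zero)))
  obtain ⟨γ, φ, hφ, hγ⟩ := exists_subseq_weaklyTendsto hT (x := fun n => x (n + N))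
    (fun n => norm_vel_le_of_action_le (by finiteness) (hN (n + N) (Nat.le_add_left _ _)).le)
    (fun n => (hx (n + N)).2.1)
  have hmem : γ ∈ Gamma m α T φm φp := ⟨_, fun n => hx (φ n + N), hγ⟩
  exact ⟨γ, hmem, le_antisymm (action_le_of_weaklyTendsto hT hγ
    (((tendsto_add_atTop_iff_nat N).2 hlim).comp hφ.tendsto_atTop)) (iInf₂_le γ hmem)⟩

theorem minimizer_mem_GammaStar (hm : 0 < m) (hα : 0 < α) (hα2 : α < 2) (hT : 0 < T)
    (hφ : (1 - α / 2) * |φp - φm| < Real.pi) {γ : H1Curve T} (hγ : γ ∈ Gamma m α T φm φp)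
    (hγc : action m α T γ = cbar m α T φm φp) :
    γ ∈ GammaStar m α T φm φp ∧ action m α T γ < action m α T (xbar m α φm φp) := by
  obtain ⟨x, hx, hxa⟩ := exists_mem_GammaStar_action_lt hm hα hα2 hT hφ
  have hlt : action m α T γ < ENNReal.ofReal (2 * jacobi m α (rbar m α T)) :=
    (hγc.trans_le (iInf₂_le x (GammaStar_subset_Gamma hx))).trans_lt hxa
  exact ⟨mem_GammaStar_of_mem_Gamma hT hγ fun t ht h0 =>
      (two_jacobi_le_action_of_mem_Gamma hm hα hα2 hT hγ ht h0).not_gt hlt,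
    hlt.trans_le (two_jacobi_le_action_xbar hm hα hα2 hT)⟩

end Existence

theorem one_sub_half_mul_lt_pi {α δ : ℝ} (hα : 1 ≤ α) (hα2 : α < 2) (hδ : δ ≤ 2 * Real.pi)
    (h : 1 < α ∨ δ < 2 * Real.pi) : (1 - α / 2) * δ < Real.pi := by
  have hpi := Real.pi_pos
  rcases h with h | h <;> nlinarith

end Kepler

end

theorem theorem3_general (m α T φm φp : ℝ) (hm : 0 < m) (hα : 0 < α) (hα2 : α < 2) (hT : 0 < T) :
    (Kepler.cbar m α T φm φp < ⊤ ∧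
      ∃ γ ∈ Kepler.Gamma m α T φm φp,
        Kepler.action m α T (γ : ℝ → ℂ) = Kepler.cbar m α T φm φp) ∧
    ∀ γ ∈ Kepler.Gamma m α T φm φp,
      Kepler.action m α T (γ : ℝ → ℂ) = Kepler.cbar m α T φm φp →
      ((1 - α / 2) * |φp - φm| < Real.pi →
        (γ ∈ Kepler.GammaStar m α T φm φp ∧
          Kepler.action m α T (γ : ℝ → ℂ) < Kepler.action m α T (Kepler.xbar m α φm φp)) ∧
        Kepler.IsSolutionOn m α (Icc (-T) T) (γ : ℝ → ℂ)) ∧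
      Kepler.IsSolutionOn m α {t ∈ Icc (-T) T | (γ : ℝ → ℂ) t ≠ 0} (γ : ℝ → ℂ) := by
  have hfin := Kepler.cbar_lt_top (φm := φm) (φp := φp) hm hα hα2 hT
  refine ⟨⟨hfin, Kepler.exists_minimizer hm hα hα2 hT⟩, fun γ hγ hγc => ?_⟩
  have hsol := Kepler.isSolutionOn_of_minimizer hm.le hα hT hγ (hγc ▸ hfin.ne)
    fun y hy => hγc.trans_le (iInf₂_le y hy)
  refine ⟨fun hφ => ?_, hsol⟩
  obtain ⟨hstar, hlt⟩ := Kepler.minimizer_mem_GammaStar hm hα hα2 hT hφ hγ hγc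
  exact ⟨⟨hstar, hlt⟩, by rwa [sep_eq_self_iff_mem_true.2 hstar.1] at hsol⟩

theorem theorem3 (m α T φm φp : ℝ) (hm : 0 < m) (hα : 1 ≤ α) (hα2 : α < 2) (hT : 0 < T)
    (hφ : |φp - φm| ≤ 2 * Real.pi) :
    (Kepler.cbar m α T φm φp < ⊤ ∧
      ∃ γ ∈ Kepler.Gamma m α T φm φp,
        Kepler.action m α T (γ : ℝ → ℂ) = Kepler.cbar m α T φm φp) ∧
    ∀ γ ∈ Kepler.Gamma m α T φm φp,
      Kepler.action m α T (γ : ℝ → ℂ) = Kepler.cbar m α T φm φp →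
      (1 < α →
        γ ∈ Kepler.GammaStar m α T φm φp ∧
        Kepler.action m α T (γ : ℝ → ℂ) < Kepler.action m α T (Kepler.xbar m α φm φp)) ∧
      (α = 1 → |φp - φm| < 2 * Real.pi →
        γ ∈ Kepler.GammaStar m α T φm φp ∧
        Kepler.action m α T (γ : ℝ → ℂ) < Kepler.action m α T (Kepler.xbar m α φm φp)) ∧
      (φp ≠ φm →
        (1 < α ∨ |φp - φm| < 2 * Real.pi →
          Kepler.IsSolutionOn m α (Icc (-T) T) (γ : ℝ → ℂ)) ∧
        Kepler.IsSolutionOn m α {t ∈ Icc (-T) T | (γ : ℝ → ℂ) t ≠ 0} (γ : ℝ → ℂ)) := by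
  obtain ⟨hmin, h⟩ := theorem3_general m α T φm φp hm (by linarith) hα2 hT
  refine ⟨hmin, fun γ hγ hγc => ?_⟩
  have hstar := fun hor => (h γ hγ hγc).1 (Kepler.one_sub_half_mul_lt_pi hα hα2 hφ hor)
  exact ⟨fun h1 => (hstar (.inl h1)).1, fun _ h2 => (hstar (.inr h2)).1,
    fun _ => ⟨fun hor => (hstar hor).2, (h γ hγ hγc).2⟩⟩
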